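/- Let $n \ge 0$ be an integer. For a bit string $x \in \{0,1\}^n$ let $|x|$ denote its Hamming weight, and let $\mathrm{Th}_t(x) = 1$ if $|x| \ge t$ and $0$ otherwise (for an integer $t \ge 0$), and $\mathrm{Parity}(x) = x_1 \oplus \cdots \oplus x_n$. For $\pi \in S_n$ let $D(\pi)$ be the unitary permuting $n$ qubits, $D(\pi)|i_1\rangle\cdots|i_n\rangle = |i_{\pi^{-1}(1)}\rangle\cdots|i_{\pi^{-1}(n)}\rangle$, and for a partition $\lambda \vdash n$ let $P_\lambda = \frac{d_\lambda}{n!}\sum_{\pi\in S_n}\chi_\lambda(\pi)D(\pi)$, where $d_\lambda$ and $\chi_\lambda$ are the dimension and the character of the irreducible representation of $S_n$ labelled by $\lambda$. The operators $(P_\lambda)_{\lambda \vdash n}$ form a quantum measurement on $n$ qubits (weak Schur sampling). The standard algorithm performs this measurement and, on outcome $\lambda = (n-\ell,\ell)$, outputs the guess $\widetilde{k} = \ell$ for $|x|$ (in general, $\widetilde k$ is the second part of $\lambda$, or $0$ if there is none). Then the following hold. 1. For every integer $t \ge 0$ there is a randomized map $q$ from $\{0,1\}$ to $\{0,1\}$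 (depending only on $n$ and $t$) such that the procedure which runs the standard algorithm to get $\widetilde{k}$, computes the bit $b = 1$ if $\widetilde{k} \ge t$ and $b = 0$ otherwise, and outputs a bit drawn from the distribution $q(b)$, has the following property: for every $x \in \{0,1\}^n$ with $|x| \le \lfloor n/2 \rfloor$, every $2\times 2$ unitary $U$ and every $\sigma \in S_n$, given the state $D(\sigma)\,U^{\otimes n}|x\rangle$, it outputs $\mathrm{Th}_t(x)$ with probability at least $1 - \frac{t}{n+1}$. 2. There is a randomized map $q$ from $\{0,1\}$ to $\{0,1\}$ (depending only on $n$) such that the procedure which runs the standard algorithm to get $\widetilde{k}$, computes the bit $b = \widetilde{k} \bmod 2$, and outputs a bit drawn from the distribution $q(b)$, has the following property: for every $x \in \{0,1\}^n$ with $|x| \le \lfloor n/2 \rfloor$, every $2\times 2$ unitary $U$ and every $\sigma \in S_n$, given the state $D(\sigma)\,U^{\otimes n}|x\rangle$, it outputs $\mathrm{Parity}(x)$ with probability at least $\frac12 + \frac{1}{2(n+1)}$. -/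

import Mathlib

noncomputable section

namespace HiddenBasis

open scoped ComplexOrder Matrix

/-! ### Quantum measurements and classical post-processing -/

/-- A quantum measurement (POVM) with classical outcomes in `α`, on the Hilbert space `ℂ^ι`.
By Naimark's theorem these are exactly the procedures which take a quantum state and output an
element of `α`, possibly using ancillas, randomness and intermediate measurements. -/
structure Measurement (ι α : Type) [Fintype ι] [DecidableEq ι] [Fintype α] where
  /-- The positive operator attached to each outcome. -/
  effect : α → Matrix ι ι ℂ
  posSemidef : ∀ a, (effect a).PosSemidef
  sum_effect : ∑ a, effect a = 1

namespace Measurement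

variable {ι α β : Type} [Fintype ι] [DecidableEq ι] [Fintype α] [Fintype β]

/-- Born rule: the probability of outcome `a` when measuring the pure state `ψ`. -/
def prob (M : Measurement ι α) (ψ : ι → ℂ) (a : α) : ℝ :=
  (star ψ ⬝ᵥ (M.effect a *ᵥ ψ)).re

/-- Randomized classical post-processing: perform `M`; on outcome `a`, output a random element
drawn from the distribution `q a`. -/
def postprocess (M : Measurement ι α) (q : α → PMF β) : Measurement ι β where
  effect b := ∑ a, (((q a b).toReal : ℝ) : ℂ) • M.effect a
  posSemidef b := Matrix.posSemidef_sum _ fun a _ =>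
    (M.posSemidef a).smul (by exact_mod_cast ENNReal.toReal_nonneg)
  sum_effect := by
    have h : ∀ a, ∑ b, (((q a b).toReal : ℝ) : ℂ) = 1 := fun a => by
      have h1 : ∑ b, q a b = 1 := by rw [← tsum_fintype (L := .unconditional β)]; exact (q a).tsum_coe
      rw [← Complex.ofReal_sum, ← ENNReal.toReal_sum fun b _ => (q a).apply_ne_top b, h1]
      simp
    rw [Finset.sum_comm]
    simp_rw [← Finset.sum_smul, h, one_smul]
    exact M.sum_effect

end Measurement

/-! ### Irreducible representations of the symmetric group -/

/-- The permutation representation of `S_n` on formal combinations of row assignments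
`r : {1, …, n} → ℕ`, by `π • r = r ∘ π⁻¹`. A row assignment with `μ_i` entries in row `i` is a
tabloid of shape `μ`. -/
def tabloidRep (n : ℕ) : Representation ℂ (Equiv.Perm (Fin n)) ((Fin n → ℕ) →₀ ℂ) where
  toFun π := Finsupp.lmapDomain ℂ ℂ fun r => r ∘ ⇑π⁻¹
  map_one' := by ext; simp
  map_mul' π τ := by ext; simp [Function.comp_assoc]

/-- A tableau of shape `μ`: a bijective filling of the cells of `μ` by `{1, …, n}`. -/
abbrev Tableau (n : ℕ) (μ : YoungDiagram) : Type := Fin n ≃ μ.cells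

/-- The polytabloid `∑_q sgn(q) q{t}`, the sum running over the column stabilizer of `t`. -/
def polytabloid {n : ℕ} {μ : YoungDiagram} (t : Tableau n μ) : (Fin n → ℕ) →₀ ℂ :=
  ∑ q : Equiv.Perm (Fin n) with ∀ i, (t (q i)).1.2 = (t i).1.2,
    ((Equiv.Perm.sign q : ℤ) : ℂ) • tabloidRep n q (Finsupp.single (fun i => (t i).1.1) 1)

/-- The Specht module of shape `μ`: the span of all polytabloids of shape `μ`. -/
def spechtModule (n : ℕ) (μ : YoungDiagram) : Submodule ℂ ((Fin n → ℕ) →₀ ℂ) :=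
  Submodule.span ℂ (Set.range (polytabloid : Tableau n μ → _))

theorem tabloidRep_polytabloid {n : ℕ} {μ : YoungDiagram} (π : Equiv.Perm (Fin n))
    (t : Tableau n μ) : tabloidRep n π (polytabloid t) = polytabloid (π⁻¹.trans t) := by
  simp only [polytabloid, map_sum, map_smul]
  refine Finset.sum_bij' (fun q _ => π * q * π⁻¹) (fun q _ => π⁻¹ * q * π) ?_ ?_ ?_ ?_ ?_
  · intro q hq
    refine Finset.mem_filter.2 ⟨Finset.mem_univ _, fun i => ?_⟩
    simpa using (Finset.mem_filter.1 hq).2 (π⁻¹ i)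
  · intro q hq
    refine Finset.mem_filter.2 ⟨Finset.mem_univ _, fun i => ?_⟩
    simpa using (Finset.mem_filter.1 hq).2 (π i)
  · intro q _
    group
  · intro q _
    group
  · intro q _
    have hs : Equiv.Perm.sign (π * q * π⁻¹) = Equiv.Perm.sign q := by
      simp [mul_comm, ← mul_assoc]
    rw [hs]
    have hx : ∀ x, π⁻¹ ((π * q * π⁻¹)⁻¹ x) = q⁻¹ (π⁻¹ x) := fun x => by
      rw [← Equiv.Perm.mul_apply, ← Equiv.Perm.mul_apply]
      congr 1
      group
    simp only [tabloidRep, MonoidHom.coe_mk, OneHom.coe_mk, Finsupp.lmapDomain_apply,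
      Finsupp.mapDomain_single, Function.comp_def, Equiv.trans_apply, hx]

/-- The irreducible representation `V_μ` of `S_n`, as the Specht module of shape `μ`. -/
def spechtRep (n : ℕ) (μ : YoungDiagram) :
    Representation ℂ (Equiv.Perm (Fin n)) (spechtModule n μ) :=
  (tabloidRep n).subrepresentation (spechtModule n μ) fun π => Submodule.span_le.2 <| by
    rintro _ ⟨t, rfl⟩
    exact Submodule.subset_span ⟨π⁻¹.trans t, (tabloidRep_polytabloid π t).symm⟩

/-- The Young diagram of a partition `p` of `n`. -/
def diagram {n : ℕ} (p : Nat.Partition n) : YoungDiagram :=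
  YoungDiagram.ofRowLens (p.parts.sort (· ≥ ·)) (p.parts.pairwise_sort (· ≥ ·)).sortedGE

/-- The character `χ_μ` of `V_μ`. -/
def spechtCharacter (n : ℕ) (μ : YoungDiagram) (π : Equiv.Perm (Fin n)) : ℂ :=
  LinearMap.trace ℂ (spechtModule n μ) (spechtRep n μ π)

/-! ### Qubits and weak Schur sampling -/

/-- Basis labels of `n` qubits. Vectors of the state space are functions `Bits n → ℂ`. -/
abbrev Bits (n : ℕ) : Type := Fin n → Fin 2

/-- The action of a permutation on `n` qubits:
`D(π)|i₁ ⋯ iₙ⟩ = |i_{π⁻¹(1)} ⋯ i_{π⁻¹(n)}⟩`. -/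
def permuteQubits {n : ℕ} (π : Equiv.Perm (Fin n)) : Matrix (Bits n) (Bits n) ℂ :=
  Matrix.of fun y x => if y = x ∘ ⇑π⁻¹ then 1 else 0

/-- The tensor power `U^{⊗ n}`. -/
def tensorPower (n : ℕ) (U : Matrix (Fin 2) (Fin 2) ℂ) : Matrix (Bits n) (Bits n) ℂ :=
  Matrix.of fun y x => ∏ i, U (y i) (x i)

/-- The state `σ(U^{⊗ n}|x⟩)`. -/
def scrambled {n : ℕ} (x : Bits n) (U : Matrix.unitaryGroup (Fin 2) ℂ)
    (σ : Equiv.Perm (Fin n)) : Bits n → ℂ :=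
  permuteQubits σ *ᵥ (tensorPower n (U : Matrix (Fin 2) (Fin 2) ℂ) *ᵥ Pi.single x 1)

/-- `P_p = (d_p / n!) ∑_π χ_p(π) D(π)`, where `d_p` is the dimension and `χ_p` the character of
the irreducible representation of `S_n` labelled by `p`. Weak Schur sampling measures `p`. -/
def schurProjector {n : ℕ} (p : Nat.Partition n) : Matrix (Bits n) (Bits n) ℂ :=
  ((Module.finrank ℂ (spechtModule n (diagram p)) : ℂ) / (n.factorial : ℂ)) •
    ∑ π : Equiv.Perm (Fin n), spechtCharacter n (diagram p) π • permuteQubits π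

/-- The guess for `|x|` made by the standard algorithm on outcome `p`: the second part of `p`,
that is, `l` for `p = (n - l, l)`. -/
def guess {n : ℕ} (p : Nat.Partition n) : ℕ := (diagram p).rowLen 1

/-! ### The functions to be computed -/

/-- Hamming weight. -/
def weight {n : ℕ} (x : Bits n) : ℕ := Finset.card {i | x i = 1}

/-- The value of `Th_t` on strings of weight `k`. -/
def thresholdOfWeight (t k : ℕ) : Fin 2 := if t ≤ k then 1 else 0

/-- The value of `Parity` on strings of weight `k`. -/
def parityOfWeight (k : ℕ) : Fin 2 := if Odd k then 1 else 0

/-- The threshold function: `Th_t(x) = 1` iff `|x| ≥ t`. -/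
def threshold {n : ℕ} (t : ℕ) (x : Bits n) : Fin 2 := thresholdOfWeight t (weight x)

/-- The parity function `x₁ ⊕ ⋯ ⊕ xₙ` (addition in `Fin 2` is modulo 2). -/
def parity {n : ℕ} (x : Bits n) : Fin 2 := ∑ i, x i

/-- Perform `W`, whose outcome is a partition of `n`, let `k` be the guess of the standard
algorithm, and output a random bit with the distribution `q (f k)`. -/
def correctedGuess {n : ℕ} (W : Measurement (Bits n) (Nat.Partition n)) (f : ℕ → Fin 2)
    (q : Fin 2 → PMF (Fin 2)) : Measurement (Bits n) (Fin 2) :=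
  W.postprocess fun p => q (f (guess p))

end HiddenBasis

end

open HiddenBasis

/-!
Write `S_μ` for the Specht module of shape `μ`, `e_t` for the polytabloid of a tableau `t`, and
`b_t` for the column antisymmetrizer of `t`. Rows are numbered from `0`: a shape has at most two
rows when `rowLen 2 = 0`, and then `l = rowLen 1` is the length of its second row.

**The representations.** The pairing of `u` with `e_t` is the coefficient of `b_t u` at the tabloid
of `t`, so a vector of `S_μ` killed by all `b_t` is zero
(`eq_zero_of_columnAntisymmetrizer_eq_zero`). Hence nothing maps equivariantly to or from `S_μ` if
the `b_t` of shape `μ` act as zero. This rules out maps between two-row Specht modules of different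
shapes, and maps from the qubit space to `S_μ` if `μ` has more than two rows, since two of three
bits are equal. If `μ` has two rows, `b_t` maps `S_μ` to the line of `e_t`
(`columnAntisymmetrizer_eq_smul`), so the endomorphisms of `S_μ` are scalars. Averaging rank-one
maps over the group turns these facts into statements on `∑_π χ_μ(π) π`: it vanishes where no
intertwining map exists (`characterSum_eq_zero`), and is `n! / d_μ` on `S_μ` itself
(`characterSum_self`).

**The qubit space.** For `t` of shape `(n - l, l)` and any function `g` of the weight, the map
`e_t ↦ g(|y|) ∏_j (y_{b_j} - y_{a_j})`, where `(a_j, b_j)` are the columns of length two of `t`,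
extends to an equivariant map from `S_{(n-l,l)}` to the qubit space. These products of singlets with
symmetric states span the space (`eq_top_of_singlets_mem`): exchanging a `0` and a `1` outside the
pairs changes a state by one with a further singlet, so modulo those a state can be symmetrized.
Therefore the operators `P_λ` are determined by acting as `1` or `0` on the images of the Specht
modules. This shows that they are idempotent, real, and add up to `1`; they are symmetric since
`χ(π⁻¹) = χ(π)`, hence positive semidefinite.

**The distribution.** The operator `P_λ` commutes with permutations and with `U^{⊗ n}`, so the
outcome is distributed as on `|x⟩`, and depends only on `k = |x|`. For `k ≤ n / 2` the restriction
of `P_λ` to weight `k` is a projection onto one copy of `S_λ` if `l ≤ k`, and zero otherwise. Taking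
traces, the guess is `l` with probability `d_l / C(n, k)` for `l ≤ k`, where
`∑_{l ≤ k} d_l = C(n, k)` (`choose_mul_sum_guess`, `sum_twoRowDim`).

**The correction.** For thresholds `t ≤ n / 2`, a guess `≥ t` is never wrong, and a
string of weight `≥ t` leads to a guess `< t` with probability at most
`C(n, t - 1) / C(n, t) = t / (n - t + 1)`; answering `1` with probability `t / (n + 1)` on a guess
`< t` balances the errors. For the parity, the guess is right with
probability `1 - k / n`; the worst weight is `⌊n / 2⌋`, and replacing a guess of the other
parity by its parity with probability `1 / (n + 1)` balances the two.
-/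

noncomputable section

namespace HiddenBasis

open scoped ComplexOrder Matrix

/-! ### Schur's lemma and averaging over a finite group -/

section Averaging

variable {G X Y : Type*} [Group G] [Fintype G] [AddCommMonoid X] [Module ℂ X]
  [AddCommMonoid Y] [Module ℂ Y]

/-- The linear map `φ` commutes with the actions `ρ` and `σ`. -/
def Intertwines (ρ : Representation ℂ G X) (σ : Representation ℂ G Y) (φ : X →ₗ[ℂ] Y) : Prop :=
  ∀ g x, φ (ρ g x) = σ g (φ x)

/-- The average (not normalized) of a linear map over the group. -/
def average (ρ : Representation ℂ G X) (σ : Representation ℂ G Y) (T : X →ₗ[ℂ] Y) : X →ₗ[ℂ] Y :=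
  ∑ g, σ g ∘ₗ T ∘ₗ ρ g⁻¹

theorem average_apply (ρ : Representation ℂ G X) (σ : Representation ℂ G Y) (T : X →ₗ[ℂ] Y)
    (x : X) : average ρ σ T x = ∑ g, σ g (T (ρ g⁻¹ x)) := by
  simp [average, LinearMap.sum_apply]

theorem intertwines_average (ρ : Representation ℂ G X) (σ : Representation ℂ G Y)
    (T : X →ₗ[ℂ] Y) : Intertwines ρ σ (average ρ σ T) := by
  intro h x
  rw [average_apply, average_apply, map_sum]
  refine Fintype.sum_equiv (Equiv.mulLeft h⁻¹) _ _ fun g => ?_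
  simp only [Equiv.coe_mulLeft, mul_inv_rev, inv_inv, map_mul, Module.End.mul_apply]
  rw [← Module.End.mul_apply, ← Module.End.mul_apply, ← map_mul, ← map_mul]
  simp

/-- The operator `∑_g χ(g) ρ(g)`, where `χ` is the character of `σ`. -/
def characterSum (ρ : Representation ℂ G X) (σ : Representation ℂ G Y) : X →ₗ[ℂ] X :=
  ∑ g, LinearMap.trace ℂ Y (σ g) • ρ g

theorem characterSum_apply (ρ : Representation ℂ G X) (σ : Representation ℂ G Y) (x : X) :
    characterSum ρ σ x = ∑ g, LinearMap.trace ℂ Y (σ g) • ρ g x := by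
  simp [characterSum, LinearMap.sum_apply]

/-- A character sum commutes with intertwining maps. -/
theorem Intertwines.map_characterSum {Z : Type*} [AddCommMonoid Z] [Module ℂ Z]
    {ρ : Representation ℂ G X} {τ : Representation ℂ G Z} {φ : X →ₗ[ℂ] Z}
    (hφ : Intertwines ρ τ φ) (σ : Representation ℂ G Y) (x : X) :
    φ (characterSum ρ σ x) = characterSum τ σ (φ x) := by
  simp only [characterSum_apply, map_sum, map_smul, hφ _ _]

/-- Matrix coefficients of a character sum, written as the trace of an averaged rank-one map. -/
theorem dual_characterSum (ρ : Representation ℂ G X) (σ : Representation ℂ G Y)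
    (hσ : ∀ g, LinearMap.trace ℂ Y (σ g⁻¹) = LinearMap.trace ℂ Y (σ g)) [Module.Finite ℂ Y]
    (f : Module.Dual ℂ X) (x : X) (A : Y →ₗ[ℂ] Y)
    (hA : ∀ y, A y = average ρ σ (f.smulRight y) x) :
    f (characterSum ρ σ x) = LinearMap.trace ℂ Y A := by
  have : A = ∑ g, f (ρ g⁻¹ x) • σ g := by
    ext y
    simp [hA, average_apply, LinearMap.sum_apply]
  rw [this, characterSum_apply]
  simp only [map_sum, map_smul, smul_eq_mul]
  refine Fintype.sum_equiv (Equiv.inv G) _ _ fun g => ?_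
  simp [hσ, mul_comm]

/-- If no nonzero map intertwines `ρ` and `σ`, then the character sum of `σ` vanishes on `ρ`. -/
theorem characterSum_eq_zero [Module.Projective ℂ X]
    (ρ : Representation ℂ G X) (σ : Representation ℂ G Y)
    (hσ : ∀ g, LinearMap.trace ℂ Y (σ g⁻¹) = LinearMap.trace ℂ Y (σ g)) [Module.Finite ℂ Y]
    (h : ∀ φ : X →ₗ[ℂ] Y, Intertwines ρ σ φ → φ = 0) : characterSum ρ σ = 0 := by
  ext x
  rw [LinearMap.zero_apply, ← Module.forall_dual_apply_eq_zero_iff ℂ]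
  intro f
  rw [dual_characterSum ρ σ hσ f x 0, map_zero]
  intro y
  rw [h _ (intertwines_average ρ σ _)]
  simp

/-- If `σ` has only scalar endomorphisms, then its own normalized character sum is the identity. -/
theorem characterSum_self {Y : Type*} [AddCommGroup Y] [Module ℂ Y]
    (σ : Representation ℂ G Y)
    (hσ : ∀ g, LinearMap.trace ℂ Y (σ g⁻¹) = LinearMap.trace ℂ Y (σ g)) [Module.Finite ℂ Y]
    (h : ∀ φ : Y →ₗ[ℂ] Y, Intertwines σ σ φ → ∃ c : ℂ, φ = c • LinearMap.id) (x : Y) :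
    ((Module.finrank ℂ Y : ℂ) / Fintype.card G) • characterSum σ σ x = x := by
  rcases subsingleton_or_nontrivial Y with hY | hY
  · exact Subsingleton.elim _ _
  have hd : (Module.finrank ℂ Y : ℂ) ≠ 0 := by
    exact_mod_cast (Module.finrank_pos (R := ℂ) (M := Y)).ne'
  have hG : (Fintype.card G : ℂ) ≠ 0 := by exact_mod_cast Fintype.card_ne_zero
  rw [← sub_eq_zero, ← Module.forall_dual_apply_eq_zero_iff ℂ]
  intro f
  -- the scalar by which an averaged rank-one map acts is found by taking its trace
  have hav : ∀ y, average σ σ (f.smulRight y) =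
      ((Fintype.card G : ℂ) / Module.finrank ℂ Y * f y) • LinearMap.id := by
    intro y
    obtain ⟨c, hc⟩ := h _ (intertwines_average σ σ (f.smulRight y))
    have ht := congrArg (LinearMap.trace ℂ Y) hc
    have h1 : LinearMap.trace ℂ Y (average σ σ (f.smulRight y)) = Fintype.card G * f y := by
      rw [average, map_sum]
      have : ∀ g, LinearMap.trace ℂ Y (σ g ∘ₗ (f.smulRight y) ∘ₗ σ g⁻¹) = f y := by
        intro g
        rw [LinearMap.trace_comp_comm', LinearMap.comp_assoc, ← Module.End.mul_eq_comp (σ g⁻¹),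
          ← map_mul, inv_mul_cancel, map_one, Module.End.one_eq_id, LinearMap.comp_id]
        simp
      simp [this]
    rw [h1, map_smul, LinearMap.trace_id, smul_eq_mul] at ht
    rw [hc]
    congr 1
    field_simp
    rw [ht]
  rw [map_sub, map_smul, dual_characterSum σ σ hσ f x
    (((Fintype.card G : ℂ) / Module.finrank ℂ Y) • f.smulRight x)]
  · simp
    field_simp
    simp
  · intro y
    rw [hav]
    simp [mul_smul]

end Averaging

/-! ### Column antisymmetrizers and Specht modules -/

section Specht

variable {n : ℕ} {μ : YoungDiagram} {X Y : Type*} [AddCommMonoid X] [Module ℂ X]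
  [AddCommMonoid Y] [Module ℂ Y]

/-- The column stabilizer of a tableau. -/
def columnStabilizer (t : Tableau n μ) : Finset (Equiv.Perm (Fin n)) :=
  {q | ∀ i, (t (q i)).1.2 = (t i).1.2}

theorem mem_columnStabilizer {t : Tableau n μ} {q : Equiv.Perm (Fin n)} :
    q ∈ columnStabilizer t ↔ ∀ i, (t (q i)).1.2 = (t i).1.2 := by
  simp [columnStabilizer]

theorem mul_mem_columnStabilizer {t : Tableau n μ} {q s : Equiv.Perm (Fin n)}
    (hq : q ∈ columnStabilizer t) (hs : s ∈ columnStabilizer t) : q * s ∈ columnStabilizer t := by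
  rw [mem_columnStabilizer] at *
  intro i
  rw [Equiv.Perm.mul_apply, hq, hs]

theorem inv_mem_columnStabilizer {t : Tableau n μ} {q : Equiv.Perm (Fin n)}
    (hq : q ∈ columnStabilizer t) : q⁻¹ ∈ columnStabilizer t := by
  rw [mem_columnStabilizer] at *
  intro i
  rw [← hq, Equiv.Perm.coe_inv, Equiv.apply_symm_apply]

theorem one_mem_columnStabilizer (t : Tableau n μ) : 1 ∈ columnStabilizer t := by
  simp [mem_columnStabilizer]

theorem swap_mem_columnStabilizer {t : Tableau n μ} {i j : Fin n}
    (h : (t i).1.2 = (t j).1.2) : Equiv.swap i j ∈ columnStabilizer t := by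
  rw [mem_columnStabilizer]
  intro k
  rw [Equiv.swap_apply_def]
  split_ifs with h1 h2
  · rw [h1, h]
  · rw [h2, h]
  · rfl

/-- The action of `∑_q sgn(q) q`, the sum running over the column stabilizer of `t`. -/
def columnAntisymmetrizer (ρ : Representation ℂ (Equiv.Perm (Fin n)) X) (t : Tableau n μ) :
    X →ₗ[ℂ] X :=
  ∑ q ∈ columnStabilizer t, ((Equiv.Perm.sign q : ℤ) : ℂ) • ρ q

theorem columnAntisymmetrizer_apply (ρ : Representation ℂ (Equiv.Perm (Fin n)) X)
    (t : Tableau n μ) (x : X) : columnAntisymmetrizer ρ t x =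
      ∑ q ∈ columnStabilizer t, ((Equiv.Perm.sign q : ℤ) : ℂ) • ρ q x := by
  simp [columnAntisymmetrizer, LinearMap.sum_apply]

theorem Intertwines.map_columnAntisymmetrizer {ρ : Representation ℂ (Equiv.Perm (Fin n)) X}
    {σ : Representation ℂ (Equiv.Perm (Fin n)) Y} {φ : X →ₗ[ℂ] Y} (hφ : Intertwines ρ σ φ)
    (t : Tableau n μ) (x : X) :
    φ (columnAntisymmetrizer ρ t x) = columnAntisymmetrizer σ t (φ x) := by
  simp only [columnAntisymmetrizer_apply, map_sum, map_smul, hφ _ _]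

theorem sign_mul_sign (q : Equiv.Perm (Fin n)) :
    ((Equiv.Perm.sign q : ℤ) : ℂ) * ((Equiv.Perm.sign q : ℤ) : ℂ) = 1 := by
  rw [← Int.cast_mul, ← Units.val_mul, Int.units_mul_self]
  simp

theorem columnAntisymmetrizer_rep (ρ : Representation ℂ (Equiv.Perm (Fin n)) X)
    {t : Tableau n μ} {q : Equiv.Perm (Fin n)} (hq : q ∈ columnStabilizer t) (x : X) :
    columnAntisymmetrizer ρ t (ρ q x) =
      ((Equiv.Perm.sign q : ℤ) : ℂ) • columnAntisymmetrizer ρ t x := by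
  simp only [columnAntisymmetrizer_apply, Finset.smul_sum]
  refine Finset.sum_bij' (fun s _ => s * q) (fun s _ => s * q⁻¹) ?_ ?_ ?_ ?_ ?_
  · intro s hs
    exact mul_mem_columnStabilizer hs hq
  · intro s hs
    exact mul_mem_columnStabilizer hs (inv_mem_columnStabilizer hq)
  · intro s _
    simp
  · intro s _
    simp
  · intro s _
    rw [smul_smul, Equiv.Perm.sign_mul, Units.val_mul, Int.cast_mul, mul_left_comm, sign_mul_sign,
      mul_one, map_mul, Module.End.mul_apply]

theorem rep_columnAntisymmetrizer (ρ : Representation ℂ (Equiv.Perm (Fin n)) X)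
    {t : Tableau n μ} {q : Equiv.Perm (Fin n)} (hq : q ∈ columnStabilizer t) (x : X) :
    ρ q (columnAntisymmetrizer ρ t x) =
      ((Equiv.Perm.sign q : ℤ) : ℂ) • columnAntisymmetrizer ρ t x := by
  simp only [columnAntisymmetrizer_apply, Finset.smul_sum, map_sum, map_smul]
  refine Finset.sum_bij' (fun s _ => q * s) (fun s _ => q⁻¹ * s) ?_ ?_ ?_ ?_ ?_
  · intro s hs
    exact mul_mem_columnStabilizer hq hs
  · intro s hs
    exact mul_mem_columnStabilizer (inv_mem_columnStabilizer hq) hs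
  · intro s _
    simp
  · intro s _
    simp
  · intro s _
    rw [smul_smul, Equiv.Perm.sign_mul, Units.val_mul, Int.cast_mul, ← mul_assoc, sign_mul_sign,
      one_mul, map_mul, Module.End.mul_apply]

/-- A vector fixed by a transposition within a column is killed by the column antisymmetrizer. -/
theorem columnAntisymmetrizer_eq_zero {X : Type*} [AddCommGroup X] [Module ℂ X]
    (ρ : Representation ℂ (Equiv.Perm (Fin n)) X)
    {t : Tableau n μ} {i j : Fin n} (hij : i ≠ j) (hc : (t i).1.2 = (t j).1.2) {x : X}
    (hx : ρ (Equiv.swap i j) x = x) : columnAntisymmetrizer ρ t x = 0 := by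
  have h := columnAntisymmetrizer_rep ρ (swap_mem_columnStabilizer hc) x
  rw [hx, Equiv.Perm.sign_swap hij] at h
  simp only [Units.val_neg, Units.val_one, Int.cast_neg, Int.cast_one, neg_smul, one_smul] at h
  have h2 : (2 : ℂ) • columnAntisymmetrizer ρ t x = 0 := by
    rw [two_smul]
    exact add_eq_zero_iff_eq_neg.2 h
  exact (smul_eq_zero.1 h2).resolve_left two_ne_zero

theorem columnAntisymmetrizer_sq (ρ : Representation ℂ (Equiv.Perm (Fin n)) X)
    (t : Tableau n μ) (x : X) :
    columnAntisymmetrizer ρ t (columnAntisymmetrizer ρ t x) =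
      ((columnStabilizer t).card : ℂ) • columnAntisymmetrizer ρ t x := by
  conv_lhs => rw [columnAntisymmetrizer_apply]
  rw [Finset.sum_congr rfl fun q hq => by
    rw [rep_columnAntisymmetrizer ρ hq, smul_smul, sign_mul_sign, one_smul]]
  rw [Finset.sum_const, Nat.cast_smul_eq_nsmul]

theorem card_columnStabilizer_ne_zero (t : Tableau n μ) :
    ((columnStabilizer t).card : ℂ) ≠ 0 := by
  exact_mod_cast (Finset.card_pos.2 ⟨1, one_mem_columnStabilizer t⟩).ne'

/-- The row assignment of a tableau. -/
def tabloid (t : Tableau n μ) : Fin n → ℕ := fun i => (t i).1.1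

theorem polytabloid_eq (t : Tableau n μ) : polytabloid t =
    columnAntisymmetrizer (tabloidRep n) t (Finsupp.single (tabloid t) 1) := by
  rw [columnAntisymmetrizer_apply]
  rfl

theorem tabloidRep_apply (π : Equiv.Perm (Fin n)) (u : (Fin n → ℕ) →₀ ℂ) (r : Fin n → ℕ) :
    tabloidRep n π u r = u (r ∘ π) := by
  have hinj : Function.Injective fun r : Fin n → ℕ => r ∘ ⇑π⁻¹ := fun r s h => by
    funext i
    simpa using congrFun h (π i)
  have hr : r = (fun r : Fin n → ℕ => r ∘ ⇑π⁻¹) (r ∘ π) := by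
    funext i
    simp
  conv_lhs => rw [hr]
  exact Finsupp.mapDomain_apply hinj _ _

theorem tabloidRep_single (π : Equiv.Perm (Fin n)) (r : Fin n → ℕ) :
    tabloidRep n π (Finsupp.single r 1) = Finsupp.single (r ∘ ⇑π⁻¹) 1 := by
  simp [tabloidRep]

theorem polytabloid_mem (t : Tableau n μ) : polytabloid t ∈ spechtModule n μ :=
  Submodule.subset_span ⟨t, rfl⟩

instance : Module.Finite ℂ (spechtModule n μ) :=
  FiniteDimensional.span_of_finite ℂ (Set.finite_range _)

theorem free_submodule {V : Type*} [AddCommGroup V] [Module ℂ V] (W : Submodule ℂ V) :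
    Module.Free ℂ W := inferInstance

-- Instance search does not unify the two additive structures of `Finsupp` here.
instance : Module.Free ℂ (spechtModule n μ) :=
  free_submodule (V := (Fin n → ℕ) →₀ ℂ) (spechtModule n μ)

theorem intertwines_subtype :
    Intertwines (spechtRep n μ) (tabloidRep n) (spechtModule n μ).subtype := fun _ _ => rfl

theorem columnAntisymmetrizer_polytabloid (t : Tableau n μ) :
    columnAntisymmetrizer (spechtRep n μ) t ⟨polytabloid t, polytabloid_mem t⟩ =
      ((columnStabilizer t).card : ℂ) • ⟨polytabloid t, polytabloid_mem t⟩ := by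
  apply Subtype.ext
  refine (intertwines_subtype.map_columnAntisymmetrizer t
    (⟨polytabloid t, polytabloid_mem t⟩ : spechtModule n μ)).trans ?_
  rw [Submodule.coe_smul_of_tower, Submodule.subtype_apply]
  simp only [polytabloid_eq]
  exact columnAntisymmetrizer_sq _ _ _

/-- A linear map on a Specht module is determined by its values on polytabloids. -/
theorem specht_hom_ext {X : Type*} [AddCommMonoid X] [Module ℂ X]
    {φ ψ : spechtModule n μ →ₗ[ℂ] X}
    (h : ∀ t : Tableau n μ, φ ⟨polytabloid t, polytabloid_mem t⟩ =
      ψ ⟨polytabloid t, polytabloid_mem t⟩) : φ = ψ := by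
  ext ⟨u, hu⟩
  induction hu using Submodule.span_induction with
  | mem x h' => obtain ⟨t, rfl⟩ := h'; exact h t
  | zero => exact (map_zero φ).trans (map_zero ψ).symm
  | add x y hx hy h1 h2 =>
    have e : (⟨x + y, Submodule.add_mem _ hx hy⟩ : spechtModule n μ) = ⟨x, hx⟩ + ⟨y, hy⟩ := rfl
    rw [e, map_add, map_add, h1, h2]
  | smul a x hx h1 =>
    have e : (⟨a • x, Submodule.smul_mem _ a hx⟩ : spechtModule n μ) = a • ⟨x, hx⟩ := rfl
    rw [e, map_smul, map_smul, h1]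

/-- Any two tableaux of the same shape differ by a permutation of the labels. -/
theorem tabloidRep_polytabloid_trans (s t : Tableau n μ) :
    tabloidRep n (s.trans t.symm) (polytabloid s) = polytabloid t := by
  rw [tabloidRep_polytabloid]
  congr 1
  ext i : 1
  rw [Equiv.trans_apply]
  change s (t.trans s.symm i) = t i
  simp

/-- The elements of a Specht module are supported on tabloids of its shape. -/
theorem exists_tabloid_of_ne_zero {u : (Fin n → ℕ) →₀ ℂ} (hu : u ∈ spechtModule n μ)
    {r : Fin n → ℕ} (hr : u r ≠ 0) : ∃ t : Tableau n μ, r = tabloid t := by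
  contrapose! hr
  induction hu using Submodule.span_induction with
  | mem x h =>
    obtain ⟨t, rfl⟩ := h
    rw [polytabloid_eq, columnAntisymmetrizer_apply, Finsupp.finsetSum_apply]
    refine Finset.sum_eq_zero fun q _ => ?_
    rw [Finsupp.smul_apply, tabloidRep_single, Finsupp.single_apply, if_neg, smul_zero]
    intro h
    exact hr (q⁻¹.trans t) (by rw [← h]; rfl)
  | zero => rfl
  | add x y _ _ hx hy => rw [Finsupp.add_apply, hx, hy, add_zero]
  | smul a x _ hx => rw [Finsupp.smul_apply, hx, smul_zero]

/-- The pairing of a vector with a polytabloid is the coefficient at the tabloid of its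
antisymmetrization, because column antisymmetrizers are self-adjoint. -/
theorem sum_mul_polytabloid (u : (Fin n → ℕ) →₀ ℂ) (t : Tableau n μ) :
    (polytabloid t).sum (fun r c => c * star (u r)) =
      star (columnAntisymmetrizer (tabloidRep n) t u (tabloid t)) := by
  let L : ((Fin n → ℕ) →₀ ℂ) →ₗ[ℂ] ℂ := Finsupp.linearCombination ℂ fun r => star (u r)
  have hL : (polytabloid t).sum (fun r c => c * star (u r)) = L (polytabloid t) := by
    rw [Finsupp.linearCombination_apply]
    rfl
  rw [hL, polytabloid_eq, columnAntisymmetrizer_apply, columnAntisymmetrizer_apply,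
    Finsupp.finsetSum_apply, star_sum, map_sum]
  refine Finset.sum_bij' (fun q _ => q⁻¹) (fun q _ => q⁻¹) ?_ ?_ ?_ ?_ ?_
  · intro q hq
    exact inv_mem_columnStabilizer hq
  · intro q hq
    exact inv_mem_columnStabilizer hq
  · intro q _
    simp
  · intro q _
    simp
  · intro q _
    rw [map_smul, tabloidRep_single, Finsupp.smul_apply, tabloidRep_apply,
      Finsupp.linearCombination_single]
    simp

/-- A vector of a Specht module which is killed by all column antisymmetrizers vanishes: it is
orthogonal to all polytabloids, hence to itself. -/
theorem eq_zero_of_columnAntisymmetrizer_eq_zero {u : (Fin n → ℕ) →₀ ℂ}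
    (hu : u ∈ spechtModule n μ)
    (h : ∀ t : Tableau n μ, columnAntisymmetrizer (tabloidRep n) t u = 0) : u = 0 := by
  let L : ((Fin n → ℕ) →₀ ℂ) →ₗ[ℂ] ℂ := Finsupp.linearCombination ℂ fun r => star (u r)
  have hle : spechtModule n μ ≤ LinearMap.ker L := by
    refine Submodule.span_le.2 ?_
    rintro _ ⟨t, rfl⟩
    have := sum_mul_polytabloid u t
    rw [h t, Finsupp.zero_apply, star_zero] at this
    rw [SetLike.mem_coe, LinearMap.mem_ker, Finsupp.linearCombination_apply]
    exact this
  have h0 : ∑ r ∈ u.support, u r * star (u r) = 0 := by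
    have := LinearMap.mem_ker.1 (hle hu)
    rwa [Finsupp.linearCombination_apply] at this
  have h1 : ∀ r ∈ u.support, u r * star (u r) = 0 :=
    (Finset.sum_eq_zero_iff_of_nonneg fun r _ => mul_star_self_nonneg (u r)).1 h0
  ext r
  by_contra hr
  have := h1 r (Finsupp.mem_support_iff.2 hr)
  simp at this
  exact hr this

/-- An intertwining map from a representation killed by the column antisymmetrizers of shape `μ`
to the Specht module of shape `μ` vanishes. -/
theorem Intertwines.eq_zero_of_columnAntisymmetrizer_target
    {X : Type*} [AddCommGroup X] [Module ℂ X]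
    {ρ : Representation ℂ (Equiv.Perm (Fin n)) X} {φ : X →ₗ[ℂ] spechtModule n μ}
    (hφ : Intertwines ρ (spechtRep n μ) φ)
    (h : ∀ (t : Tableau n μ) x, columnAntisymmetrizer ρ t x = 0) : φ = 0 := by
  ext x : 1
  apply Subtype.ext
  refine eq_zero_of_columnAntisymmetrizer_eq_zero (φ x).2 fun t => ?_
  have := intertwines_subtype.map_columnAntisymmetrizer t (φ x)
  rw [← hφ.map_columnAntisymmetrizer, h, map_zero, map_zero] at this
  exact this.symm

/-- An intertwining map from a Specht module of shape `μ` to a representation killed by the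
column antisymmetrizers of shape `μ` vanishes. -/
theorem Intertwines.eq_zero_of_columnAntisymmetrizer_source
    {X : Type*} [AddCommGroup X] [Module ℂ X]
    {ρ : Representation ℂ (Equiv.Perm (Fin n)) X} {φ : spechtModule n μ →ₗ[ℂ] X}
    (hφ : Intertwines (spechtRep n μ) ρ φ)
    (h : ∀ (t : Tableau n μ) x, columnAntisymmetrizer ρ t x = 0) : φ = 0 := by
  refine specht_hom_ext fun t => ?_
  have h2 := hφ.map_columnAntisymmetrizer t ⟨polytabloid t, polytabloid_mem t⟩
  rw [columnAntisymmetrizer_polytabloid, h, map_smul] at h2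
  exact (smul_eq_zero.1 h2).resolve_left (card_columnStabilizer_ne_zero t)

/-- The character of a symmetric group takes the same value at inverse elements, because these are
conjugate. -/
theorem trace_spechtRep_inv (π : Equiv.Perm (Fin n)) :
    LinearMap.trace ℂ _ (spechtRep n μ π⁻¹) = LinearMap.trace ℂ _ (spechtRep n μ π) := by
  have h : IsConj π π⁻¹ := Equiv.Perm.isConj_iff_cycleType_eq.2 (Equiv.Perm.cycleType_inv π).symm
  obtain ⟨c, hc⟩ := isConj_iff.1 h
  rw [← hc, map_mul, LinearMap.trace_mul_comm, ← map_mul]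
  simp

end Specht

/-! ### Functions of bit strings that are antisymmetric in disjoint pairs of positions -/

section Pairs

variable {n l : ℕ}

theorem fin_two_eq_one {z : Fin 2} (h : z ≠ 0) : z = 1 := by omega

/-- The wave function `∏_j (y_{b_j} - y_{a_j})` of a product of singlets on the pairs
`(a_j, b_j)`. -/
def singlets (a b : Fin l → Fin n) (y : Bits n) : ℂ :=
  ∏ j, (((y (b j)).val : ℂ) - ((y (a j)).val : ℂ))

/-- The string which has `0` at all `a_j`, has `1` at all `b_j`, and agrees with `y` elsewhere. -/
def setPairs (a b : Fin l → Fin n) (y : Bits n) : Bits n := fun i =>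
  open Classical in if i ∈ Set.range a then 0 else if i ∈ Set.range b then 1 else y i

theorem setPairs_left (a b : Fin l → Fin n) (y : Bits n) (j : Fin l) :
    setPairs a b y (a j) = 0 := by
  simp [setPairs]

theorem setPairs_right {a b : Fin l → Fin n} (hab : ∀ i j, a i ≠ b j) (y : Bits n) (j : Fin l) :
    setPairs a b y (b j) = 1 := by
  simp [setPairs, hab]

theorem setPairs_of_notMem {a b : Fin l → Fin n} (y : Bits n) {i : Fin n}
    (ha : i ∉ Set.range a) (hb : i ∉ Set.range b) : setPairs a b y i = y i := by
  simp only [setPairs, if_neg ha, if_neg hb]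

theorem setPairs_eq_self {a b : Fin l → Fin n} {y : Bits n} (ha : ∀ j, y (a j) = 0)
    (hb : ∀ j, y (b j) = 1) : setPairs a b y = y := by
  funext i
  unfold setPairs
  split_ifs with h1 h2
  · obtain ⟨j, rfl⟩ := h1
    exact (ha j).symm
  · obtain ⟨j, rfl⟩ := h2
    exact (hb j).symm
  · rfl

theorem setPairs_swap (a b : Fin l → Fin n) (y : Bits n) (j : Fin l) :
    setPairs a b (y ∘ Equiv.swap (a j) (b j)) = setPairs a b y := by
  funext i
  unfold setPairs
  split_ifs with h1 h2
  · rfl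
  · rfl
  · rw [Function.comp_apply, Equiv.swap_apply_of_ne_of_ne]
    · rintro rfl
      exact h1 ⟨j, rfl⟩
    · rintro rfl
      exact h2 ⟨j, rfl⟩

theorem singlets_swap {a b : Fin l → Fin n} (ha : Function.Injective a)
    (hb : Function.Injective b) (hab : ∀ i j, a i ≠ b j) (y : Bits n) (j : Fin l) :
    singlets a b (y ∘ Equiv.swap (a j) (b j)) = -singlets a b y := by
  have : ∀ k, (((y (Equiv.swap (a j) (b j) (b k))).val : ℂ) -
      ((y (Equiv.swap (a j) (b j) (a k))).val : ℂ)) =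
      (if k = j then -1 else 1) * (((y (b k)).val : ℂ) - ((y (a k)).val : ℂ)) := by
    intro k
    split_ifs with h
    · subst h
      rw [Equiv.swap_apply_right, Equiv.swap_apply_left]
      ring
    · rw [Equiv.swap_apply_of_ne_of_ne (hab j k).symm (hb.ne h),
        Equiv.swap_apply_of_ne_of_ne (ha.ne h) (hab k j), one_mul]
  simp only [singlets, Function.comp_apply, this, Finset.prod_mul_distrib]
  simp

theorem singlets_eq_zero {a b : Fin l → Fin n} {y : Bits n} {j : Fin l} (h : y (a j) = y (b j)) :
    singlets a b y = 0 :=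
  Finset.prod_eq_zero (Finset.mem_univ j) (by rw [h, sub_self])

theorem singlets_eq_one {a b : Fin l → Fin n} {y : Bits n} (ha : ∀ j, y (a j) = 0)
    (hb : ∀ j, y (b j) = 1) : singlets a b y = 1 :=
  Finset.prod_eq_one fun j _ => by simp [ha, hb]

/-- A function antisymmetric under the transpositions `(a_j b_j)` is determined by its values at
strings with `0` at all `a_j` and `1` at all `b_j`. -/
theorem eq_singlets_mul {a b : Fin l → Fin n} (ha : Function.Injective a)
    (hb : Function.Injective b) (hab : ∀ i j, a i ≠ b j) {f : Bits n → ℂ}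
    (hf : ∀ j y, f (y ∘ Equiv.swap (a j) (b j)) = -f y) (y : Bits n) :
    f y = singlets a b y * f (setPairs a b y) := by
  -- induction on the number of pairs with `0` at `b_j`
  induction hm : Finset.card {j | y (b j) = 0} using Nat.strong_induction_on generalizing y with
  | _ m ih =>
  by_cases h0 : ∃ j, y (a j) = y (b j)
  · obtain ⟨j, hj⟩ := h0
    have hy : y ∘ Equiv.swap (a j) (b j) = y := by
      funext i
      rw [Function.comp_apply, Equiv.swap_apply_def]
      split_ifs with h1 h2
      · rw [h1, hj]
      · rw [h2, hj]
      · rfl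
    have := hf j y
    rw [hy] at this
    rw [singlets_eq_zero hj, zero_mul]
    exact self_eq_neg.1 this
  push Not at h0
  by_cases h1 : ∃ j, y (b j) = 0
  · obtain ⟨j, hj⟩ := h1
    have hlt : Finset.card {k | (y ∘ Equiv.swap (a j) (b j)) (b k) = 0} < m := by
      rw [← hm]
      refine Finset.card_lt_card (Finset.ssubset_iff_of_subset ?_ |>.2 ⟨j, by simp [hj], ?_⟩)
      · intro k hk
        simp only [Finset.mem_filter, Finset.mem_univ, true_and, Function.comp_apply] at hk ⊢
        by_cases hkj : k = j
        · rw [hkj, hj]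
        · rwa [Equiv.swap_apply_of_ne_of_ne (hab j k).symm (hb.ne hkj)] at hk
      · simp only [Finset.mem_filter, Finset.mem_univ, true_and, Function.comp_apply,
          Equiv.swap_apply_right]
        rw [← hj]
        exact h0 j
    have := ih _ hlt (y ∘ Equiv.swap (a j) (b j)) rfl
    rwa [hf, singlets_swap ha hb hab, setPairs_swap, neg_mul, neg_inj] at this
  · push Not at h1
    have hb1 : ∀ j, y (b j) = 1 := fun j => fin_two_eq_one (h1 j)
    have ha0 : ∀ j, y (a j) = 0 := fun j => by
      by_contra h
      exact h0 j (by rw [fin_two_eq_one h, hb1])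
    rw [setPairs_eq_self ha0 hb1, singlets_eq_one ha0 hb1, one_mul]

/-- A string of weight less than the number of pairs is constant on some pair. -/
theorem exists_eq_of_weight_lt {a b : Fin l → Fin n} (ha : Function.Injective a)
    (hb : Function.Injective b) (hab : ∀ i j, a i ≠ b j) {y : Bits n} (hy : weight y < l) :
    ∃ j, y (a j) = y (b j) := by
  by_contra! h
  refine hy.not_ge ?_
  let f : Fin l → Fin n := fun j => if y (b j) = 1 then b j else a j
  have hinj : Function.Injective f := by
    intro i j hij
    simp only [f] at hij
    split_ifs at hij with h1 h2 h2
    · exact hb hij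
    · exact absurd hij.symm (hab _ _)
    · exact absurd hij (hab _ _)
    · exact ha hij
  have hf : ∀ j, y (f j) = 1 := by
    intro j
    simp only [f]
    split_ifs with h1
    · exact h1
    · have := h j
      omega
  calc l = (Finset.univ.image f).card := by rw [Finset.card_image_of_injective _ hinj]; simp
    _ ≤ weight y := Finset.card_le_card fun i hi => by
        obtain ⟨j, -, rfl⟩ := Finset.mem_image.1 hi
        simpa using hf j

theorem singlets_eq_zero_of_weight_lt {a b : Fin l → Fin n} (ha : Function.Injective a)
    (hb : Function.Injective b) (hab : ∀ i j, a i ≠ b j) {y : Bits n} (hy : weight y < l) :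
    singlets a b y = 0 := by
  obtain ⟨j, hj⟩ := exists_eq_of_weight_lt ha hb hab hy
  exact singlets_eq_zero hj

theorem weight_comp (y : Bits n) (π : Equiv.Perm (Fin n)) : weight (y ∘ π) = weight y := by
  refine Finset.card_equiv π fun i => ?_
  simp

/-- Strings of the same weight differ by a permutation of the positions. -/
theorem exists_comp_eq_of_weight_eq {x y : Bits n} (h : weight x = weight y) :
    ∃ π : Equiv.Perm (Fin n), y = x ∘ π := by
  have e : {i // y i = 1} ≃ {i // x i = 1} := Fintype.equivOfCardEq (by
    rw [Fintype.card_subtype, Fintype.card_subtype]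
    exact h.symm)
  refine ⟨e.extendSubtype, ?_⟩
  funext i
  rw [Function.comp_apply]
  by_cases hi : y i = 1
  · rw [hi, e.extendSubtype_mem i hi]
  · have := e.extendSubtype_not_mem i hi
    omega

end Pairs

/-! ### Tableaux with two rows -/

section TwoRows

variable {n : ℕ} {μ : YoungDiagram}

/-- The entry of `t` in the first row and column `j`, for `j` less than the length of the second
row. -/
def upper (t : Tableau n μ) (j : Fin (μ.rowLen 1)) : Fin n :=
  t.symm ⟨(0, j), (YoungDiagram.mem_cells _).2 <| YoungDiagram.mem_iff_lt_rowLen.2 <|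
    j.2.trans_le (μ.rowLen_anti 0 1 zero_le_one)⟩

/-- The entry of `t` in the second row and column `j`. -/
def lower (t : Tableau n μ) (j : Fin (μ.rowLen 1)) : Fin n :=
  t.symm ⟨(1, j), (YoungDiagram.mem_cells _).2 <| YoungDiagram.mem_iff_lt_rowLen.2 j.2⟩

theorem apply_upper (t : Tableau n μ) (j : Fin (μ.rowLen 1)) :
    (t (upper t j)).1 = (0, (j : ℕ)) := by
  simp [upper]

theorem apply_lower (t : Tableau n μ) (j : Fin (μ.rowLen 1)) :
    (t (lower t j)).1 = (1, (j : ℕ)) := by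
  simp [lower]

theorem upper_injective (t : Tableau n μ) : Function.Injective (upper t) := fun i j h => by
  have := apply_upper t i
  rw [h, apply_upper] at this
  simpa [Fin.ext_iff, eq_comm] using this

theorem lower_injective (t : Tableau n μ) : Function.Injective (lower t) := fun i j h => by
  have := apply_lower t i
  rw [h, apply_lower] at this
  simpa [Fin.ext_iff, eq_comm] using this

theorem upper_ne_lower (t : Tableau n μ) (i j : Fin (μ.rowLen 1)) : upper t i ≠ lower t j :=
  fun h => by
    have := apply_upper t i
    rw [h, apply_lower] at this
    simp at this

theorem swap_upper_lower_mem (t : Tableau n μ) (j : Fin (μ.rowLen 1)) :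
    Equiv.swap (upper t j) (lower t j) ∈ columnStabilizer t :=
  swap_mem_columnStabilizer (by rw [apply_upper, apply_lower])

theorem tabloid_eq_one_iff (t : Tableau n μ) (i : Fin n) :
    tabloid t i = 1 ↔ i ∈ Set.range (lower t) := by
  constructor
  · intro h
    have hm := (YoungDiagram.mem_cells _).1 (t i).2
    have h1 : (t i).1 = (1, (t i).1.2) := Prod.ext h rfl
    rw [h1, YoungDiagram.mem_iff_lt_rowLen] at hm
    refine ⟨⟨_, hm⟩, t.injective (Subtype.ext ?_)⟩
    rw [apply_lower]
    exact h1.symm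
  · rintro ⟨j, rfl⟩
    rw [tabloid, apply_lower]

theorem tabloid_le_one (h2 : μ.rowLen 2 = 0) (t : Tableau n μ) (i : Fin n) : tabloid t i ≤ 1 := by
  by_contra! h
  have hm := (YoungDiagram.mem_cells _).1 (t i).2
  have h1 : (t i).1 = (tabloid t i, (t i).1.2) := rfl
  rw [h1, YoungDiagram.mem_iff_lt_rowLen] at hm
  have := μ.rowLen_anti 2 (tabloid t i) h
  omega

/-- A bit string as a row assignment with rows `0` and `1`. -/
def bitsRow (y : Bits n) : Fin n → ℕ := fun i => (y i).val

theorem bitsRow_injective : Function.Injective (bitsRow : Bits n → Fin n → ℕ) := fun x y h => by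
  funext i
  exact Fin.ext (congrFun h i)

theorem card_range_lower (t : Tableau n μ) :
    (Finset.univ.image (lower t)).card = μ.rowLen 1 := by
  rw [Finset.card_image_of_injective _ (lower_injective t)]
  simp

theorem exists_bitsRow (h2 : μ.rowLen 2 = 0) (t : Tableau n μ) :
    ∃ y : Bits n, tabloid t = bitsRow y ∧ weight y = μ.rowLen 1 := by
  refine ⟨fun i => ⟨tabloid t i, Nat.lt_succ_of_le (tabloid_le_one h2 t i)⟩, rfl, ?_⟩
  rw [← card_range_lower t, weight]
  congr 1
  ext i
  simpa [Fin.ext_iff] using tabloid_eq_one_iff t i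

/-- The only row assignment with the weight of a two-row tableau which is `0` at the upper and
`1` at the lower entries is the one of the tableau. -/
theorem bitsRow_setPairs (h2 : μ.rowLen 2 = 0) (t : Tableau n μ) {y : Bits n}
    (hy : weight (setPairs (upper t) (lower t) y) = μ.rowLen 1) :
    bitsRow (setPairs (upper t) (lower t) y) = tabloid t := by
  have hsub : Finset.univ.image (lower t) ⊆
      ({i | setPairs (upper t) (lower t) y i = 1} : Finset (Fin n)) := by
    intro i hi
    obtain ⟨j, -, rfl⟩ := Finset.mem_image.1 hi
    simpa using setPairs_right (upper_ne_lower t) y j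
  have heq := Finset.eq_of_subset_of_card_le hsub (by
    rw [card_range_lower]
    exact hy.le)
  funext i
  have h1 : setPairs (upper t) (lower t) y i = 1 ↔ tabloid t i = 1 := by
    rw [tabloid_eq_one_iff]
    simpa using (Finset.ext_iff.1 heq i).symm
  have h3 := tabloid_le_one h2 t i
  unfold bitsRow
  generalize setPairs (upper t) (lower t) y i = z at *
  generalize tabloid t i = r at *
  omega

/-- A column-preserving permutation which preserves the second row of a two-row tableau is the
identity. -/
theorem eq_one_of_mem_columnStabilizer (h2 : μ.rowLen 2 = 0) {t : Tableau n μ}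
    {q : Equiv.Perm (Fin n)} (hq : q ∈ columnStabilizer t)
    (h : ∀ i, tabloid t i = 1 → tabloid t (q i) = 1) : q = 1 := by
  rw [mem_columnStabilizer] at hq
  have h1 : ∀ i, tabloid t i = 1 → q i = i := fun i hi =>
    t.injective (Subtype.ext (Prod.ext ((h i hi).trans hi.symm) (hq i)))
  ext1 i
  by_cases hi : tabloid t i = 1
  · exact h1 i hi
  by_cases hqi : tabloid t (q i) = 1
  · exact q.injective (h1 _ hqi)
  have := tabloid_le_one h2 t i
  have := tabloid_le_one h2 t (q i)
  exact t.injective (Subtype.ext (Prod.ext (show tabloid t (q i) = tabloid t i by omega) (hq i)))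

theorem polytabloid_apply_tabloid (h2 : μ.rowLen 2 = 0) (t : Tableau n μ) :
    polytabloid t (tabloid t) = 1 := by
  rw [polytabloid_eq, columnAntisymmetrizer_apply, Finsupp.finsetSum_apply,
    Finset.sum_eq_single_of_mem 1 (one_mem_columnStabilizer t)]
  · simp
  · intro q hq hq1
    rw [Finsupp.smul_apply, tabloidRep_single, Finsupp.single_apply, if_neg, smul_zero]
    intro h
    refine hq1 (eq_one_of_mem_columnStabilizer h2 hq fun i hi => ?_)
    rw [← h]
    simpa using hi

theorem columnAntisymmetrizer_mem (t : Tableau n μ) {u : (Fin n → ℕ) →₀ ℂ}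
    (hu : u ∈ spechtModule n μ) : columnAntisymmetrizer (tabloidRep n) t u ∈ spechtModule n μ := by
  have := intertwines_subtype.map_columnAntisymmetrizer t (⟨u, hu⟩ : spechtModule n μ)
  rw [Submodule.subtype_apply, Submodule.subtype_apply] at this
  rw [← this]
  exact Subtype.coe_prop _

/-- In a two-row Specht module, the column antisymmetrizer of a tableau maps every vector to a
multiple of the polytabloid: both are antisymmetric functions on strings of fixed weight. -/
theorem columnAntisymmetrizer_eq_smul (h2 : μ.rowLen 2 = 0) (t : Tableau n μ)
    {u : (Fin n → ℕ) →₀ ℂ} (hu : u ∈ spechtModule n μ) :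
    columnAntisymmetrizer (tabloidRep n) t u =
      columnAntisymmetrizer (tabloidRep n) t u (tabloid t) • polytabloid t := by
  have hmem := columnAntisymmetrizer_mem t hu
  have hanti : ∀ (w : (Fin n → ℕ) →₀ ℂ) (j : Fin (μ.rowLen 1)) (y : Bits n),
      columnAntisymmetrizer (tabloidRep n) t w
        (bitsRow (y ∘ Equiv.swap (upper t j) (lower t j))) =
        -columnAntisymmetrizer (tabloidRep n) t w (bitsRow y) := by
    intro w j y
    have := rep_columnAntisymmetrizer (tabloidRep n) (swap_upper_lower_mem t j) w
    rw [Equiv.Perm.sign_swap (upper_ne_lower t j j)] at this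
    have h3 := DFunLike.congr_fun this (bitsRow y)
    rw [tabloidRep_apply] at h3
    simpa [Finsupp.smul_apply] using! h3
  have hform := fun (w : (Fin n → ℕ) →₀ ℂ) (y : Bits n) => eq_singlets_mul
    (upper_injective t) (lower_injective t) (upper_ne_lower t)
    (f := fun y => columnAntisymmetrizer (tabloidRep n) t w (bitsRow y)) (hanti w) y
  have hwt : ∀ w ∈ spechtModule n μ, ∀ y : Bits n, weight y ≠ μ.rowLen 1 → w (bitsRow y) = 0 := by
    intro w hw y hy
    by_contra h
    obtain ⟨s, hs⟩ := exists_tabloid_of_ne_zero hw h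
    obtain ⟨z, hz, hz'⟩ := exists_bitsRow h2 s
    rw [hz] at hs
    exact hy (bitsRow_injective hs ▸ hz')
  have hpt := polytabloid_mem t
  have key : ∀ y : Bits n, columnAntisymmetrizer (tabloidRep n) t u (bitsRow y) =
      columnAntisymmetrizer (tabloidRep n) t u (tabloid t) * polytabloid t (bitsRow y) := by
    intro y
    have h4 := hform (Finsupp.single (tabloid t) 1) y
    rw [← polytabloid_eq] at h4
    rw [hform u y, h4]
    by_cases hy : weight (setPairs (upper t) (lower t) y) = μ.rowLen 1
    · rw [bitsRow_setPairs h2 t hy, polytabloid_apply_tabloid h2]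
      ring
    · rw [hwt _ hmem _ hy, hwt _ hpt _ hy]
      ring
  ext r
  rw [Finsupp.smul_apply, smul_eq_mul]
  by_cases hr : ∃ y : Bits n, r = bitsRow y
  · obtain ⟨y, rfl⟩ := hr
    exact key y
  · have h0 : ∀ w ∈ spechtModule n μ, w r = 0 := by
      intro w hw
      by_contra h
      obtain ⟨s, hs⟩ := exists_tabloid_of_ne_zero hw h
      obtain ⟨z, hz, -⟩ := exists_bitsRow h2 s
      exact hr ⟨z, hs.trans hz⟩
    rw [h0 _ hmem, h0 _ hpt, mul_zero]

/-- The endomorphisms of a two-row Specht module are scalars. -/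
theorem Intertwines.exists_eq_smul_id (h2 : μ.rowLen 2 = 0)
    {φ : spechtModule n μ →ₗ[ℂ] spechtModule n μ}
    (hφ : Intertwines (spechtRep n μ) (spechtRep n μ) φ) : ∃ c : ℂ, φ = c • LinearMap.id := by
  rcases isEmpty_or_nonempty (Tableau n μ) with hE | ⟨⟨t⟩⟩
  · exact ⟨0, specht_hom_ext fun t => hE.elim t⟩
  let e : ∀ s : Tableau n μ, spechtModule n μ := fun s => ⟨polytabloid s, polytabloid_mem s⟩
  have h1 : (columnStabilizer t).card • (φ (e t) : (Fin n → ℕ) →₀ ℂ) =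
      columnAntisymmetrizer (tabloidRep n) t (φ (e t)) := by
    have h4 := hφ.map_columnAntisymmetrizer t (e t)
    rw [columnAntisymmetrizer_polytabloid, map_smul] at h4
    have h5 := congrArg (spechtModule n μ).subtype h4
    rw [intertwines_subtype.map_columnAntisymmetrizer] at h5
    rw [← Nat.cast_smul_eq_nsmul ℂ]
    exact h5
  rw [columnAntisymmetrizer_eq_smul h2 t (φ (e t)).2] at h1
  set c := columnAntisymmetrizer (tabloidRep n) t (φ (e t)) (tabloid t)
  have hct : φ (e t) = (c / (columnStabilizer t).card) • e t := by
    apply Subtype.ext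
    have h6 : (φ (e t) : (Fin n → ℕ) →₀ ℂ) = (c / (columnStabilizer t).card) • polytabloid t := by
      rw [div_eq_inv_mul, mul_smul, ← h1, ← Nat.cast_smul_eq_nsmul ℂ, smul_smul,
        inv_mul_cancel₀ (card_columnStabilizer_ne_zero t), one_smul]
    exact h6
  refine ⟨c / (columnStabilizer t).card, specht_hom_ext fun s => ?_⟩
  have hs : spechtRep n μ (t.trans s.symm) (e t) = e s :=
    Subtype.ext (tabloidRep_polytabloid_trans t s)
  change φ (e s) = (c / (columnStabilizer t).card) • e s
  rw [← hs, hφ, hct, map_smul]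

theorem characterSum_spechtRep_self (h2 : μ.rowLen 2 = 0) (u : spechtModule n μ) :
    ((Module.finrank ℂ (spechtModule n μ) : ℂ) / n.factorial) •
      characterSum (spechtRep n μ) (spechtRep n μ) u = u := by
  have := characterSum_self (spechtRep n μ) trace_spechtRep_inv
    (fun _ hφ => hφ.exists_eq_smul_id h2) u
  rwa [Fintype.card_perm, Fintype.card_fin] at this

/-- The column antisymmetrizers of a two-row shape kill the Specht modules of two-row shapes with
a shorter second row. -/
theorem columnAntisymmetrizer_spechtRep_eq_zero {ν : YoungDiagram} (h2 : ν.rowLen 2 = 0)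
    (hlt : ν.rowLen 1 < μ.rowLen 1) (t : Tableau n μ) (u : spechtModule n ν) :
    columnAntisymmetrizer (spechtRep n ν) t u = 0 := by
  apply Subtype.ext
  refine (intertwines_subtype.map_columnAntisymmetrizer t u).trans ?_
  rw [Submodule.subtype_apply, ← Finsupp.sum_single (u : (Fin n → ℕ) →₀ ℂ), Finsupp.sum, map_sum]
  refine Finset.sum_eq_zero fun r hr => ?_
  obtain ⟨s, rfl⟩ := exists_tabloid_of_ne_zero u.2 (Finsupp.mem_support_iff.1 hr)
  obtain ⟨y, hy, hw⟩ := exists_bitsRow h2 s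
  obtain ⟨j, hj⟩ := exists_eq_of_weight_lt (upper_injective t) (lower_injective t)
    (upper_ne_lower t) (y := y) (by omega)
  refine columnAntisymmetrizer_eq_zero _ (upper_ne_lower t j j)
    (by rw [apply_upper, apply_lower]) ?_
  ext r
  rw [tabloidRep_apply, Finsupp.single_apply, Finsupp.single_apply]
  have hfix : tabloid s ∘ Equiv.swap (upper t j) (lower t j) = tabloid s := by
    rw [hy]
    funext i
    rw [Function.comp_apply, Equiv.swap_apply_def]
    split_ifs with h1 h3
    · rw [h1]; exact congrArg Fin.val hj.symm
    · rw [h3]; exact congrArg Fin.val hj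
    · rfl
  congr 1
  refine propext ⟨fun h => ?_, fun h => ?_⟩
  · rw [← hfix, h]
    funext i
    simp
  · rw [← h, hfix]

theorem characterSum_spechtRep_of_ne {ν : YoungDiagram} (hμ : μ.rowLen 2 = 0)
    (hν : ν.rowLen 2 = 0) (hne : μ.rowLen 1 ≠ ν.rowLen 1) :
    characterSum (spechtRep n ν) (spechtRep n μ) = 0 := by
  refine characterSum_eq_zero (spechtRep n ν) (spechtRep n μ) trace_spechtRep_inv fun φ hφ => ?_
  rcases hne.lt_or_gt with h | h
  · exact hφ.eq_zero_of_columnAntisymmetrizer_source fun t x =>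
      columnAntisymmetrizer_spechtRep_eq_zero hμ h t x
  · exact hφ.eq_zero_of_columnAntisymmetrizer_target fun t x =>
      columnAntisymmetrizer_spechtRep_eq_zero hν h t x

end TwoRows

/-! ### The qubit space is spanned by products of singlets with symmetric states -/

section Spanning

variable {n l : ℕ}

/-- Multiplication of a wave function by a function of the weight. -/
def weightMul (g : ℕ → ℂ) : (Bits n → ℂ) →ₗ[ℂ] (Bits n → ℂ) where
  toFun f y := g (weight y) * f y
  map_add' f h := by ext; simp [mul_add]
  map_smul' c f := by ext; simp [mul_left_comm]

theorem weightMul_apply (g : ℕ → ℂ) (f : Bits n → ℂ) (y : Bits n) :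
    weightMul g f y = g (weight y) * f y := rfl

theorem singlets_mul_weight_setPairs {a b : Fin l → Fin n} (ha : Function.Injective a)
    (hb : Function.Injective b) (hab : ∀ i j, a i ≠ b j) (g : ℕ → ℂ) (y : Bits n) :
    singlets a b y * g (weight y) = singlets a b y * g (weight (setPairs a b y)) := by
  have := eq_singlets_mul ha hb hab (f := fun y => singlets a b y * g (weight y))
    (fun j y => by rw [singlets_swap ha hb hab, weight_comp, neg_mul]) y
  rw [this, singlets_eq_one (setPairs_left a b y) (setPairs_right hab y), one_mul]

/-- The product of the singlets on the pairs `(a_j, b_j)` with the basis state given by `z` on the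
remaining positions. -/
def singletsBasis (a b : Fin l → Fin n) (z : Bits n) : Bits n → ℂ := fun y =>
  open Classical in
  singlets a b y * if ∀ i, i ∉ Set.range a → i ∉ Set.range b → y i = z i then 1 else 0

theorem singletsBasis_congr {a b : Fin l → Fin n} {z w : Bits n}
    (h : ∀ i, i ∉ Set.range a → i ∉ Set.range b → z i = w i) :
    singletsBasis a b z = singletsBasis a b w := by
  funext y
  unfold singletsBasis
  congr 2
  exact propext ⟨fun h1 i hi hi' => (h1 i hi hi').trans (h i hi hi'),
    fun h1 i hi hi' => (h1 i hi hi').trans (h i hi hi').symm⟩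

/-- Exchanging a `0` and a `1` outside the pairs changes the state by one with a further
singlet. -/
theorem singletsBasis_sub_swap {a b : Fin l → Fin n} {z : Bits n} {p q : Fin n}
    (hpa : p ∉ Set.range a) (hpb : p ∉ Set.range b) (hqa : q ∉ Set.range a)
    (hqb : q ∉ Set.range b) (hp : z p = 0) (hq : z q = 1) :
    singletsBasis a b z - singletsBasis a b (z ∘ Equiv.swap p q) =
      singletsBasis (Fin.cons p a : Fin (l + 1) → Fin n) (Fin.cons q b) z := by
  have hpq : p ≠ q := by rintro rfl; rw [hp] at hq; exact absurd hq (by decide)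
  funext y
  have h1 : singlets (Fin.cons p a : Fin (l + 1) → Fin n) (Fin.cons q b) y =
      (((y q).val : ℂ) - ((y p).val : ℂ)) * singlets a b y := by
    simp [singlets, Fin.prod_univ_succ]
  rw [Pi.sub_apply]
  unfold singletsBasis
  rw [h1]
  by_cases hR : ∀ i, i ≠ p → i ≠ q → i ∉ Set.range a → i ∉ Set.range b → y i = z i
  · have e1 : (∀ i, i ∉ Set.range a → i ∉ Set.range b → y i = z i) ↔ y p = 0 ∧ y q = 1 := by
      constructor
      · intro h
        exact ⟨(h p hpa hpb).trans hp, (h q hqa hqb).trans hq⟩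
      · rintro ⟨h3, h4⟩ i hi hi'
        by_cases hip : i = p
        · rw [hip, h3, hp]
        by_cases hiq : i = q
        · rw [hiq, h4, hq]
        exact hR i hip hiq hi hi'
    have e2 : (∀ i, i ∉ Set.range a → i ∉ Set.range b → y i = (z ∘ Equiv.swap p q) i) ↔
        y p = 1 ∧ y q = 0 := by
      constructor
      · intro h
        refine ⟨(h p hpa hpb).trans ?_, (h q hqa hqb).trans ?_⟩
        · simpa using hq
        · simpa using hp
      · rintro ⟨h3, h4⟩ i hi hi'
        by_cases hip : i = p
        · rw [hip, h3, Function.comp_apply, Equiv.swap_apply_left, hq]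
        by_cases hiq : i = q
        · rw [hiq, h4, Function.comp_apply, Equiv.swap_apply_right, hp]
        rw [Function.comp_apply, Equiv.swap_apply_of_ne_of_ne hip hiq]
        exact hR i hip hiq hi hi'
    have e3 : ∀ i, i ∉ Set.range (Fin.cons p a : Fin (l + 1) → Fin n) →
        i ∉ Set.range (Fin.cons q b : Fin (l + 1) → Fin n) → y i = z i := by
      intro i hi hi'
      rw [Fin.range_cons, Set.mem_insert_iff, not_or] at hi hi'
      exact hR i hi.1 hi'.1 hi.2 hi'.2
    simp only [e1, e2, if_pos e3]
    rcases (by omega : y p = 0 ∨ y p = 1) with h3 | h3 <;>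
    rcases (by omega : y q = 0 ∨ y q = 1) with h4 | h4 <;> simp [h3, h4]
  · push Not at hR
    obtain ⟨i, hip, hiq, hia, hib, hne⟩ := hR
    rw [if_neg, if_neg, if_neg]
    · ring
    · intro h
      refine hne (h i ?_ ?_)
      · rw [Fin.range_cons, Set.mem_insert_iff, not_or]; exact ⟨hip, hia⟩
      · rw [Fin.range_cons, Set.mem_insert_iff, not_or]; exact ⟨hiq, hib⟩
    · intro h
      refine hne ((h i hia hib).trans ?_)
      rw [Function.comp_apply, Equiv.swap_apply_of_ne_of_ne hip hiq]
    · intro h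
      exact hne (h i hia hib)

/-- Of two different strings of the same weight, each has a `1` where the other has a `0`. -/
theorem exists_ne_of_weight_eq {z w : Bits n} (h : weight z = weight w) (hne : z ≠ w) :
    ∃ q, z q = 1 ∧ w q = 0 := by
  by_contra! hc
  refine hne ?_
  have hsub : ({i | z i = 1} : Finset (Fin n)) ⊆ ({i | w i = 1} : Finset (Fin n)) := by
    intro i hi
    have hi' : z i = 1 := by simpa using hi
    simpa using fin_two_eq_one (hc i hi')
  have heq := Finset.eq_of_subset_of_card_le hsub h.ge
  funext i
  have : z i = 1 ↔ w i = 1 := by simpa using Finset.ext_iff.1 heq i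
  omega

/-- Every product of singlets with a basis state on the other positions is a combination of products
of singlets with symmetric states. -/
theorem singletsBasis_mem {W : Submodule ℂ (Bits n → ℂ)}
    (hW : ∀ (l : ℕ) (a b : Fin l → Fin n), Function.Injective a → Function.Injective b →
      (∀ i j, a i ≠ b j) → ∀ g : ℕ → ℂ, weightMul g (singlets a b) ∈ W)
    {a b : Fin l → Fin n} (ha : Function.Injective a) (hb : Function.Injective b)
    (hab : ∀ i j, a i ≠ b j) (z : Bits n) : singletsBasis a b z ∈ W := by
  -- induction on the number of positions that are not in a pair
  induction hm : n - l using Nat.strong_induction_on generalizing l z with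
  | _ m ih =>
  have hswap : ∀ (z : Bits n) (p q : Fin n), p ∉ Set.range a → p ∉ Set.range b →
      q ∉ Set.range a → q ∉ Set.range b → z p = 0 → z q = 1 →
      singletsBasis a b z - singletsBasis a b (z ∘ Equiv.swap p q) ∈ W := by
    intro z p q hpa hpb hqa hqb hp hq
    rw [singletsBasis_sub_swap hpa hpb hqa hqb hp hq]
    have hpq : p ≠ q := by rintro rfl; rw [hp] at hq; exact absurd hq (by decide)
    have ha' : Function.Injective (Fin.cons p a : Fin (l + 1) → Fin n) :=
      Fin.cons_injective_iff.2 ⟨hpa, ha⟩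
    have hle : l + 1 ≤ n := by simpa using Fintype.card_le_of_injective _ ha'
    refine ih (n - (l + 1)) (by omega) ha' (Fin.cons_injective_iff.2 ⟨hqb, hb⟩) ?_ z rfl
    intro i j
    refine Fin.cases ?_ (fun i => ?_) i <;> refine Fin.cases ?_ (fun j => ?_) j
    · simpa using hpq
    · simp only [Fin.cons_zero, Fin.cons_succ]
      exact fun h => hpb ⟨j, h.symm⟩
    · simp only [Fin.cons_zero, Fin.cons_succ]
      exact fun h => hqa ⟨i, h⟩
    · simpa using hab i j
  have hsame : ∀ z w : Bits n, weight z = weight w →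
      (∀ i, i ∈ Set.range a ∨ i ∈ Set.range b → z i = w i) →
      singletsBasis a b z - singletsBasis a b w ∈ W := by
    intro z w hzw hag
    induction hd : Finset.card {i | z i ≠ w i} using Nat.strong_induction_on generalizing z with
    | _ d ihd =>
    by_cases hne : z = w
    · rw [hne, sub_self]
      exact W.zero_mem
    obtain ⟨q, hq, hq'⟩ := exists_ne_of_weight_eq hzw hne
    obtain ⟨p, hp', hp⟩ := exists_ne_of_weight_eq hzw.symm (Ne.symm hne)
    have hpR : ¬(p ∈ Set.range a ∨ p ∈ Set.range b) := fun h => by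
      have := hag p h
      rw [hp, hp'] at this
      exact absurd this (by decide)
    have hqR : ¬(q ∈ Set.range a ∨ q ∈ Set.range b) := fun h => by
      have := hag q h
      rw [hq, hq'] at this
      exact absurd this (by decide)
    have hsw := hswap z p q (fun h => hpR (Or.inl h)) (fun h => hpR (Or.inr h))
      (fun h => hqR (Or.inl h)) (fun h => hqR (Or.inr h)) hp hq
    have hoff : ∀ i, i ≠ p → i ≠ q → (z ∘ Equiv.swap p q) i = z i := fun i h1 h2 => by
      rw [Function.comp_apply, Equiv.swap_apply_of_ne_of_ne h1 h2]
    have hlt : Finset.card {i | (z ∘ Equiv.swap p q) i ≠ w i} < d := by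
      rw [← hd]
      refine Finset.card_lt_card (Finset.ssubset_iff_of_subset ?_ |>.2 ⟨p, ?_, ?_⟩)
      · intro i hi
        simp only [Finset.mem_filter, Finset.mem_univ, true_and] at hi ⊢
        by_cases h1 : i = p
        · rw [h1, hp, hp']; decide
        by_cases h2 : i = q
        · rw [h2, hq, hq']; decide
        rwa [hoff i h1 h2] at hi
      · simp [hp, hp']
      · simp [hq, hp']
    have := ihd _ hlt (z ∘ Equiv.swap p q) ((weight_comp _ _).trans hzw) (fun i hi => by
      rw [hoff i (fun h => hpR (h ▸ hi)) (fun h => hqR (h ▸ hi)), hag i hi]) rfl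
    simpa using W.add_mem hsw this
  -- a basis state on the rest agrees, up to such differences, with its symmetrization
  have hz : singletsBasis a b z = singletsBasis a b (setPairs a b z) :=
    singletsBasis_congr fun i h1 h2 => (setPairs_of_notMem z h1 h2).symm
  rw [hz]
  set z₀ := setPairs a b z with hz₀
  have hz₀' : setPairs a b z₀ = z₀ :=
    setPairs_eq_self (setPairs_left a b z) (setPairs_right hab z)
  let Z : Finset (Bits n) := {w | setPairs a b w = w ∧ weight w = weight z₀}
  have hsum : ∑ w ∈ Z, singletsBasis a b w =
      weightMul (fun k => if k = weight z₀ then 1 else 0) (singlets a b) := by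
    funext y
    rw [Finset.sum_apply, weightMul_apply, mul_comm]
    rw [singlets_mul_weight_setPairs ha hb hab (fun k => if k = weight z₀ then (1 : ℂ) else 0)]
    simp only [singletsBasis]
    rw [← Finset.mul_sum]
    congr 1
    have hiff : ∀ w ∈ Z, ((∀ i, i ∉ Set.range a → i ∉ Set.range b → y i = w i) ↔
        w = setPairs a b y) := by
      intro w hw
      have hw1 : setPairs a b w = w := by
        simp only [Z, Finset.mem_filter, Finset.mem_univ, true_and] at hw
        exact hw.1
      constructor
      · intro h
        rw [← hw1]
        funext i
        unfold setPairs
        split_ifs with h1 h2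
        · rfl
        · rfl
        · exact (h i h1 h2).symm
      · rintro rfl i h1 h2
        exact (setPairs_of_notMem y h1 h2).symm
    rw [Finset.sum_congr rfl fun w hw => if_congr (hiff w hw) rfl rfl, Finset.sum_ite_eq']
    have hidem : setPairs a b (setPairs a b y) = setPairs a b y :=
      setPairs_eq_self (setPairs_left a b y) (setPairs_right hab y)
    simp [Z, hidem]
  have hzZ : z₀ ∈ Z := by simp [Z, hz₀']
  have hcard : (Z.card : ℂ) ≠ 0 := by exact_mod_cast (Finset.card_pos.2 ⟨z₀, hzZ⟩).ne'
  have hmem : (Z.card : ℂ) • singletsBasis a b z₀ ∈ W := by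
    have h1 : ∑ w ∈ Z, (singletsBasis a b z₀ - singletsBasis a b w) ∈ W := by
      refine W.sum_mem fun w hw => ?_
      simp only [Z, Finset.mem_filter, Finset.mem_univ, true_and] at hw
      refine hsame z₀ w hw.2.symm fun i hi => ?_
      rw [← hz₀', ← hw.1]
      unfold setPairs
      split_ifs with h1 h2
      · rfl
      · rfl
      · exact absurd hi (by tauto)
    have h2 := W.add_mem h1 (hsum ▸ hW l a b ha hb hab fun k => if k = weight z₀ then 1 else 0)
    rwa [Finset.sum_sub_distrib, sub_add_cancel, Finset.sum_const, ← Nat.cast_smul_eq_nsmul ℂ]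
      at h2
  exact (W.smul_mem_iff hcard).1 hmem

/-- The products of singlets on disjoint pairs with functions of the weight span the qubit
space. -/
theorem eq_top_of_singlets_mem {W : Submodule ℂ (Bits n → ℂ)}
    (hW : ∀ (l : ℕ) (a b : Fin l → Fin n), Function.Injective a → Function.Injective b →
      (∀ i j, a i ≠ b j) → ∀ g : ℕ → ℂ, weightMul g (singlets a b) ∈ W) : W = ⊤ := by
  have hs : ∀ z : Bits n, Pi.single z 1 ∈ W := by
    intro z
    have := singletsBasis_mem hW (l := 0) (a := Fin.elim0) (b := Fin.elim0)
      (fun i => i.elim0) (fun i => i.elim0) (fun i => i.elim0) z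
    convert this using 1
    funext y
    simp [singletsBasis, singlets, Pi.single_apply, funext_iff]
  refine eq_top_iff.2 fun f _ => ?_
  have : f = ∑ z, f z • Pi.single z (1 : ℂ) := by
    funext y
    simp [Finset.sum_apply, Pi.single_apply]
  rw [this]
  exact W.sum_mem fun z _ => W.smul_mem _ (hs z)

end Spanning

/-! ### Partitions and their diagrams -/

section Diagrams

variable {n : ℕ}

theorem card_cellsOfRowLens (w : List ℕ) : (YoungDiagram.cellsOfRowLens w).card = w.sum := by
  induction w with
  | nil => rfl
  | cons a w ih =>
    rw [YoungDiagram.cellsOfRowLens, Finset.card_union_of_disjoint, Finset.card_map, ih]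
    · simp
    · rw [Finset.disjoint_left]
      rintro ⟨i, j⟩ h1 h2
      simp at h1 h2
      omega

theorem card_diagram (p : Nat.Partition n) : (diagram p).card = n := by
  refine (card_cellsOfRowLens _).trans ?_
  rw [← Multiset.sum_coe, Multiset.sort_eq, p.parts_sum]

theorem diagram_injective : Function.Injective (diagram : Nat.Partition n → YoungDiagram) := by
  intro p q h
  have hpos : ∀ p : Nat.Partition n, ∀ x ∈ p.parts.sort (· ≥ ·), 0 < x := fun p x hx =>
    p.parts_pos ((Multiset.mem_sort (· ≥ ·)).1 hx)
  have h1 := congrArg YoungDiagram.rowLens h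
  unfold diagram at h1
  rw [YoungDiagram.rowLens_ofRowLens_eq_self (hpos p),
    YoungDiagram.rowLens_ofRowLens_eq_self (hpos q)] at h1
  have h2 := congrArg (fun l : List ℕ => (l : Multiset ℕ)) h1
  simp only [Multiset.sort_eq] at h2
  exact Nat.Partition.ext h2

theorem exists_diagram_eq {μ : YoungDiagram} (h : μ.card = n) :
    ∃ p : Nat.Partition n, diagram p = μ := by
  have hsort : (μ.rowLens : Multiset ℕ).sort (· ≥ ·) = μ.rowLens := by
    rw [Multiset.coe_sort]
    exact List.mergeSort_eq_self (· ≥ ·) μ.rowLens_sorted.pairwise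
  refine ⟨⟨μ.rowLens, fun hi => μ.pos_of_mem_rowLens _ hi, ?_⟩, ?_⟩
  · rw [Multiset.sum_coe, ← card_cellsOfRowLens, ← h]
    exact congrArg YoungDiagram.card (YoungDiagram.ofRowLens_to_rowLens_eq_self (μ := μ))
  · refine Eq.trans ?_ (YoungDiagram.ofRowLens_to_rowLens_eq_self (μ := μ))
    unfold diagram
    congr 1

theorem rowLen_eq_zero_of_two_le {μ : YoungDiagram} (h2 : μ.rowLen 2 = 0) {i : ℕ} (hi : 2 ≤ i) :
    μ.rowLen i = 0 := by
  have := μ.rowLen_anti 2 i hi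
  omega

theorem card_eq_rowLen_add {μ : YoungDiagram} (h2 : μ.rowLen 2 = 0) :
    μ.card = μ.rowLen 0 + μ.rowLen 1 := by
  have : μ.cells = μ.row 0 ∪ μ.row 1 := by
    ext ⟨i, j⟩
    simp only [Finset.mem_union, YoungDiagram.mem_row_iff, YoungDiagram.mem_cells]
    constructor
    · intro h
      by_cases hi : 2 ≤ i
      · rw [YoungDiagram.mem_iff_lt_rowLen, rowLen_eq_zero_of_two_le h2 hi] at h
        omega
      · have : i = 0 ∨ i = 1 := by omega
        tauto
    · tauto
  rw [YoungDiagram.card, this, Finset.card_union_of_disjoint, ← YoungDiagram.rowLen_eq_card,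
    ← YoungDiagram.rowLen_eq_card]
  rw [Finset.disjoint_left]
  rintro c h1 h2
  rw [YoungDiagram.mem_row_iff] at h1 h2
  omega

/-- A partition with at most two parts is determined by its second part. -/
theorem eq_of_rowLen_eq {p q : Nat.Partition n} (hp : (diagram p).rowLen 2 = 0)
    (hq : (diagram q).rowLen 2 = 0) (h : (diagram p).rowLen 1 = (diagram q).rowLen 1) : p = q := by
  have h0 : (diagram p).rowLen 0 = (diagram q).rowLen 0 := by
    have h1 := card_eq_rowLen_add hp
    have h3 := card_eq_rowLen_add hq
    rw [card_diagram] at h1 h3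
    omega
  refine diagram_injective (YoungDiagram.ext (Finset.ext ?_))
  rintro ⟨i, j⟩
  simp only [YoungDiagram.mem_cells, YoungDiagram.mem_iff_lt_rowLen]
  rcases (by omega : i = 0 ∨ i = 1 ∨ 2 ≤ i) with rfl | rfl | hi
  · rw [h0]
  · rw [h]
  · rw [rowLen_eq_zero_of_two_le hp hi, rowLen_eq_zero_of_two_le hq hi]

theorem exists_twoRow {l : ℕ} (h : 2 * l ≤ n) :
    ∃ p : Nat.Partition n, (diagram p).rowLen 2 = 0 ∧ (diagram p).rowLen 1 = l := by
  have hw : ([n - l, l] : List ℕ).SortedGE :=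
    List.Pairwise.sortedGE (by simp; omega)
  let μ := YoungDiagram.ofRowLens [n - l, l] hw
  have hc : μ.card = n := by
    refine (card_cellsOfRowLens _).trans ?_
    simp
    omega
  obtain ⟨p, hp⟩ := exists_diagram_eq hc
  refine ⟨p, ?_, ?_⟩
  · rw [hp]
    by_contra h0
    have : (2, 0) ∈ μ := YoungDiagram.mem_iff_lt_rowLen.2 (Nat.pos_of_ne_zero h0)
    obtain ⟨h3, -⟩ := YoungDiagram.mem_ofRowLens.1 this
    simp at h3
  · rw [hp]
    exact YoungDiagram.rowLen_ofRowLens (w := [n - l, l]) (hw := hw) ⟨1, by simp⟩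

/-- Every choice of disjoint pairs occurs as the columns of length two of a tableau. -/
theorem exists_tableau {μ : YoungDiagram} (hc : μ.card = n) {a b : Fin (μ.rowLen 1) → Fin n}
    (ha : Function.Injective a) (hb : Function.Injective b) (hab : ∀ i j, a i ≠ b j) :
    ∃ t : Tableau n μ, upper t = a ∧ lower t = b := by
  let t : Tableau n μ := Fintype.equivOfCardEq (by simp [← hc])
  obtain ⟨σ, hσ⟩ := Equiv.Perm.exists_extending_pair (Sum.elim (upper t) (lower t)) (Sum.elim a b)
    (Sum.elim_injective.2 ⟨upper_injective t, lower_injective t, upper_ne_lower t⟩)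
    (Sum.elim_injective.2 ⟨ha, hb, hab⟩)
  exact ⟨σ.symm.trans t, funext fun j => hσ (Sum.inl j), funext fun j => hσ (Sum.inr j)⟩

end Diagrams

/-! ### The permutation action on qubits and the Specht modules in it -/

section Qubits

variable {n : ℕ} {μ : YoungDiagram}

/-- The permutation action on the state space of `n` qubits, as a representation. -/
def qubitRep (n : ℕ) : Representation ℂ (Equiv.Perm (Fin n)) (Bits n → ℂ) where
  toFun π := LinearMap.funLeft ℂ ℂ fun y => y ∘ π
  map_one' := rfl
  map_mul' _ _ := rfl

theorem qubitRep_apply (π : Equiv.Perm (Fin n)) (f : Bits n → ℂ) (y : Bits n) :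
    qubitRep n π f y = f (y ∘ π) := rfl

theorem comp_inv_eq_iff (π : Equiv.Perm (Fin n)) (x y : Bits n) :
    y = x ∘ ⇑π⁻¹ ↔ x = y ∘ π := by
  constructor <;> rintro rfl <;> funext i <;> simp

theorem permuteQubits_mulVec (π : Equiv.Perm (Fin n)) (f : Bits n → ℂ) :
    permuteQubits π *ᵥ f = qubitRep n π f := by
  funext y
  simp only [permuteQubits, Matrix.mulVec, dotProduct, Matrix.of_apply, comp_inv_eq_iff]
  simp [qubitRep_apply]

theorem intertwines_weightMul (g : ℕ → ℂ) :
    Intertwines (qubitRep n) (qubitRep n) (weightMul g) := fun π f => by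
  funext y
  simp [qubitRep_apply, weightMul_apply, weight_comp]

/-- The map which sends a row assignment to the sum of all strings that have a `1` wherever the
row is not the first. -/
def raise (n : ℕ) : ((Fin n → ℕ) →₀ ℂ) →ₗ[ℂ] (Bits n → ℂ) :=
  Finsupp.linearCombination ℂ fun r y => if ∀ i, r i ≠ 0 → y i = 1 then 1 else 0

theorem raise_single (r : Fin n → ℕ) (y : Bits n) :
    raise n (Finsupp.single r 1) y = if ∀ i, r i ≠ 0 → y i = 1 then 1 else 0 := by
  simp [raise]

theorem intertwines_raise : Intertwines (tabloidRep n) (qubitRep n) (raise n) := by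
  intro π u
  induction u using Finsupp.induction_linear with
  | zero => simp
  | add u v hu hv => rw [map_add, map_add, hu, hv, map_add, map_add]
  | single r c =>
    have h : (Finsupp.single r c : (Fin n → ℕ) →₀ ℂ) = c • Finsupp.single r 1 := by simp
    rw [h, map_smul, map_smul, map_smul, map_smul, tabloidRep_single]
    congr 1
    funext y
    rw [qubitRep_apply, raise_single, raise_single]
    congr 1
    refine propext ⟨fun h i hi => h (π i) (by simpa using hi), fun h i hi => ?_⟩
    simpa using h (π⁻¹ i) hi

/-- The image of a two-row polytabloid is the product of singlets on its columns of length two,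
with no constraint on the remaining positions. -/
theorem raise_polytabloid (h2 : μ.rowLen 2 = 0) (t : Tableau n μ) :
    raise n (polytabloid t) = singlets (upper t) (lower t) := by
  have hA : raise n (polytabloid t) =
      columnAntisymmetrizer (qubitRep n) t (raise n (Finsupp.single (tabloid t) 1)) := by
    rw [polytabloid_eq, intertwines_raise.map_columnAntisymmetrizer]
  have hanti : ∀ j y, raise n (polytabloid t) (y ∘ Equiv.swap (upper t j) (lower t j)) =
      -raise n (polytabloid t) y := by
    intro j y
    have := rep_columnAntisymmetrizer (qubitRep n) (swap_upper_lower_mem t j)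
      (raise n (Finsupp.single (tabloid t) 1))
    rw [Equiv.Perm.sign_swap (upper_ne_lower t j j), ← hA] at this
    have h3 := congrFun this y
    rw [qubitRep_apply] at h3
    simpa using h3
  funext y
  rw [eq_singlets_mul (upper_injective t) (lower_injective t) (upper_ne_lower t) hanti y]
  convert mul_one _ using 2
  rw [hA, columnAntisymmetrizer_apply, Finset.sum_apply,
    Finset.sum_eq_single_of_mem 1 (one_mem_columnStabilizer t)]
  · rw [Pi.smul_apply, qubitRep_apply, raise_single, if_pos]
    · simp
    · intro i hi
      have := tabloid_le_one h2 t i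
      obtain ⟨j, rfl⟩ := (tabloid_eq_one_iff t i).1 (by omega)
      exact setPairs_right (upper_ne_lower t) y j
  · intro q hq hq1
    rw [Pi.smul_apply, qubitRep_apply, raise_single, if_neg, smul_zero]
    intro h
    refine hq1 (eq_one_of_mem_columnStabilizer h2 hq fun i hi => ?_)
    have h3 := h i (by omega)
    have h4 := tabloid_le_one h2 t (q i)
    by_contra h5
    -- an entry of the first row in the column of an entry of the second row carries a `0`
    obtain ⟨j, rfl⟩ := (tabloid_eq_one_iff t i).1 hi
    have h6 : q (lower t j) = upper t j := by
      refine t.injective (Subtype.ext (Prod.ext ?_ ?_))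
      · rw [apply_upper]
        exact (by omega : tabloid t (q (lower t j)) = 0)
      · rw [apply_upper, mem_columnStabilizer.1 hq, apply_lower]
    rw [Function.comp_apply, h6, setPairs_left] at h3
    exact absurd h3 (by decide)

/-- The embedding of a Specht module into the qubit space, with a weight function as a
multiplier. -/
def spechtToQubits (n : ℕ) (μ : YoungDiagram) (g : ℕ → ℂ) :
    spechtModule n μ →ₗ[ℂ] (Bits n → ℂ) :=
  weightMul g ∘ₗ raise n ∘ₗ (spechtModule n μ).subtype

theorem spechtToQubits_polytabloid (h2 : μ.rowLen 2 = 0) (g : ℕ → ℂ) (t : Tableau n μ) :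
    spechtToQubits n μ g ⟨polytabloid t, polytabloid_mem t⟩ =
      weightMul g (singlets (upper t) (lower t)) :=
  congrArg (weightMul g) (raise_polytabloid h2 t)

theorem intertwines_spechtToQubits (g : ℕ → ℂ) :
    Intertwines (spechtRep n μ) (qubitRep n) (spechtToQubits n μ g) := by
  intro π u
  change weightMul g (raise n (tabloidRep n π u)) = qubitRep n π (weightMul g (raise n u))
  rw [intertwines_raise, intertwines_weightMul]

/-- A linear map on the qubit space is determined by its values on the images of polytabloids. -/
theorem qubit_hom_ext {X : Type*} [AddCommMonoid X] [Module ℂ X]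
    {A B : (Bits n → ℂ) →ₗ[ℂ] X}
    (h : ∀ p : Nat.Partition n, (diagram p).rowLen 2 = 0 → ∀ (g : ℕ → ℂ)
      (t : Tableau n (diagram p)), A (weightMul g (singlets (upper t) (lower t))) =
        B (weightMul g (singlets (upper t) (lower t)))) : A = B := by
  have htop : LinearMap.eqLocus A B = ⊤ := by
    refine eq_top_of_singlets_mem fun l a b ha hb hab g => ?_
    have hl : 2 * l ≤ n := by
      have := Fintype.card_le_of_injective _ (Sum.elim_injective.2 ⟨ha, hb, hab⟩)
      simp only [Fintype.card_sum, Fintype.card_fin] at this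
      omega
    obtain ⟨p, hp, rfl⟩ := exists_twoRow hl
    obtain ⟨t, rfl, rfl⟩ := exists_tableau (card_diagram p) ha hb hab
    exact h p hp g t
  exact LinearMap.eqLocus_eq_top.1 htop

/-- The column antisymmetrizers of a shape with more than two rows kill the qubit space, because
two of three bits are equal. -/
theorem columnAntisymmetrizer_qubitRep_eq_zero (h2 : μ.rowLen 2 ≠ 0) (t : Tableau n μ)
    (f : Bits n → ℂ) : columnAntisymmetrizer (qubitRep n) t f = 0 := by
  have hm : ∀ i ≤ 2, (i, 0) ∈ μ.cells := fun i hi =>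
    (YoungDiagram.mem_cells _).2 (YoungDiagram.mem_iff_lt_rowLen.2
      ((Nat.pos_of_ne_zero h2).trans_le (μ.rowLen_anti i 2 hi)))
  let c : Fin 3 → Fin n := fun i => t.symm ⟨(i, 0), hm i (by omega)⟩
  have hf : f = ∑ z, f z • Pi.single z (1 : ℂ) := by
    funext y
    simp [Finset.sum_apply, Pi.single_apply]
  rw [hf, map_sum]
  refine Finset.sum_eq_zero fun z _ => ?_
  rw [map_smul]
  obtain ⟨i, j, hij, hz⟩ := Fintype.exists_ne_map_eq_of_card_lt (fun i : Fin 3 => z (c i)) (by simp)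
  have hc : c i ≠ c j := by
    intro h
    have := congrArg Subtype.val (t.symm.injective h)
    simp only [Prod.mk.injEq, and_true] at this
    exact hij (Fin.ext this)
  rw [columnAntisymmetrizer_eq_zero (qubitRep n) hc (by simp [c]), smul_zero]
  have hfix : z ∘ Equiv.swap (c i) (c j) = z := by
    funext k
    rw [Function.comp_apply, Equiv.swap_apply_def]
    split_ifs with h1 h3
    · rw [h1]; exact hz.symm
    · rw [h3]; exact hz
    · rfl
  funext y
  rw [qubitRep_apply, Pi.single_apply, Pi.single_apply]
  congr 1
  refine propext ⟨fun h => ?_, fun h => ?_⟩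
  · rw [← hfix, ← h]
    funext k
    simp
  · rw [h, hfix]

end Qubits

/-! ### Weak Schur sampling as a measurement -/

section Projectors

variable {n : ℕ}

theorem schurProjector_mulVec (p : Nat.Partition n) (f : Bits n → ℂ) :
    schurProjector p *ᵥ f =
      ((Module.finrank ℂ (spechtModule n (diagram p)) : ℂ) / n.factorial) •
        characterSum (qubitRep n) (spechtRep n (diagram p)) f := by
  rw [schurProjector, Matrix.smul_mulVec, Matrix.sum_mulVec, characterSum_apply]
  congr 1
  refine Finset.sum_congr rfl fun π _ => ?_
  rw [Matrix.smul_mulVec, permuteQubits_mulVec]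
  rfl

/-- The projector of a two-row partition fixes every copy of its Specht module. -/
theorem schurProjector_mulVec_self {p : Nat.Partition n} (hp : (diagram p).rowLen 2 = 0)
    (g : ℕ → ℂ) (u : spechtModule n (diagram p)) :
    schurProjector p *ᵥ spechtToQubits n (diagram p) g u = spechtToQubits n (diagram p) g u := by
  rw [schurProjector_mulVec, ← (intertwines_spechtToQubits g).map_characterSum, ← map_smul,
    characterSum_spechtRep_self hp]

theorem schurProjector_mulVec_eq_zero {p : Nat.Partition n} (hp : (diagram p).rowLen 2 ≠ 0)
    (f : Bits n → ℂ) : schurProjector p *ᵥ f = 0 := by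
  rw [schurProjector_mulVec, characterSum_eq_zero (qubitRep n) (spechtRep n (diagram p))
    trace_spechtRep_inv fun φ hφ => hφ.eq_zero_of_columnAntisymmetrizer_target fun t x =>
      columnAntisymmetrizer_qubitRep_eq_zero hp t x]
  simp

/-- The projector of a partition kills the copies of the other two-row Specht modules. -/
theorem schurProjector_mulVec_of_ne {p q : Nat.Partition n} (hq : (diagram q).rowLen 2 = 0)
    (hpq : p ≠ q) (g : ℕ → ℂ) (u : spechtModule n (diagram q)) :
    schurProjector p *ᵥ spechtToQubits n (diagram q) g u = 0 := by
  by_cases hp : (diagram p).rowLen 2 = 0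
  · rw [schurProjector_mulVec, ← (intertwines_spechtToQubits g).map_characterSum,
      characterSum_spechtRep_of_ne hp hq fun h => hpq (eq_of_rowLen_eq hp hq h)]
    simp
  · exact schurProjector_mulVec_eq_zero hp _

theorem schurProjector_mulVec_singlets {p q : Nat.Partition n} (hq : (diagram q).rowLen 2 = 0)
    (g : ℕ → ℂ) (t : Tableau n (diagram q)) :
    schurProjector p *ᵥ weightMul g (singlets (upper t) (lower t)) =
      if p = q then weightMul g (singlets (upper t) (lower t)) else 0 := by
  rw [← spechtToQubits_polytabloid hq]
  split_ifs with h
  · subst h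
    exact schurProjector_mulVec_self hq g _
  · exact schurProjector_mulVec_of_ne hq h g _

theorem matrix_ext_singlets {A B : Matrix (Bits n) (Bits n) ℂ}
    (h : ∀ p : Nat.Partition n, (diagram p).rowLen 2 = 0 → ∀ (g : ℕ → ℂ)
      (t : Tableau n (diagram p)), A *ᵥ (weightMul g (singlets (upper t) (lower t))) =
        B *ᵥ (weightMul g (singlets (upper t) (lower t)))) : A = B := by
  apply Matrix.toLin'.injective
  exact qubit_hom_ext fun p hp g t => by simpa using h p hp g t

theorem sum_schurProjector : ∑ p : Nat.Partition n, schurProjector p = 1 := by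
  refine matrix_ext_singlets fun q hq g t => ?_
  rw [Matrix.sum_mulVec, Matrix.one_mulVec]
  simp [schurProjector_mulVec_singlets hq]

theorem schurProjector_mul_self (p : Nat.Partition n) :
    schurProjector p * schurProjector p = schurProjector p := by
  refine matrix_ext_singlets fun q hq g t => ?_
  rw [← Matrix.mulVec_mulVec, schurProjector_mulVec_singlets hq]
  split_ifs with h
  · rw [schurProjector_mulVec_singlets hq, if_pos h]
  · rw [Matrix.mulVec_zero]

/-- The matrix entries of the projectors are real, because the wave functions of products of
singlets are. -/
theorem schurProjector_map_star (p : Nat.Partition n) :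
    (schurProjector p).map star = schurProjector p := by
  have hstar : ∀ f : Bits n → ℂ, (schurProjector p).map star *ᵥ f =
      star (schurProjector p *ᵥ star f) := by
    intro f
    funext y
    simp [Matrix.mulVec, dotProduct]
  refine matrix_ext_singlets fun q hq g t => ?_
  have hreal : star (weightMul g (singlets (upper t) (lower t))) =
      weightMul (star g) (singlets (upper t) (lower t)) := by
    funext y
    simp [weightMul_apply, singlets]
  rw [hstar, hreal, schurProjector_mulVec_singlets hq, schurProjector_mulVec_singlets hq]
  split_ifs with h
  · rw [← hreal, star_star]
  · rw [star_zero]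

theorem permuteQubits_transpose (π : Equiv.Perm (Fin n)) :
    (permuteQubits π)ᵀ = permuteQubits π⁻¹ := by
  ext y x
  rw [Matrix.transpose_apply, permuteQubits, permuteQubits, Matrix.of_apply, Matrix.of_apply,
    inv_inv]
  exact if_congr (comp_inv_eq_iff π y x) rfl rfl

theorem schurProjector_transpose (p : Nat.Partition n) :
    (schurProjector p)ᵀ = schurProjector p := by
  rw [schurProjector, Matrix.transpose_smul, Matrix.transpose_sum]
  congr 1
  refine Fintype.sum_equiv (Equiv.inv _) _ _ fun π => ?_
  rw [Matrix.transpose_smul, permuteQubits_transpose, Equiv.inv_apply]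
  congr 1
  exact (trace_spechtRep_inv π).symm

theorem schurProjector_conjTranspose (p : Nat.Partition n) :
    (schurProjector p)ᴴ = schurProjector p := by
  rw [Matrix.conjTranspose, schurProjector_transpose, schurProjector_map_star]

theorem schurProjector_posSemidef (p : Nat.Partition n) : (schurProjector p).PosSemidef := by
  have := Matrix.posSemidef_conjTranspose_mul_self (schurProjector p)
  rwa [schurProjector_conjTranspose, schurProjector_mul_self] at this

/-- Weak Schur sampling. -/
def weakSchurSampling (n : ℕ) : Measurement (Bits n) (Nat.Partition n) where
  effect := schurProjector
  posSemidef := schurProjector_posSemidef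
  sum_effect := sum_schurProjector

end Projectors

/-! ### The distribution of the outcome -/

section Distribution

variable {n : ℕ}

theorem exists_singlets_ne_zero {l k : ℕ} {a b : Fin l → Fin n} (ha : Function.Injective a)
    (hb : Function.Injective b) (hab : ∀ i j, a i ≠ b j) (hlk : l ≤ k) (hk : k + l ≤ n) :
    ∃ y : Bits n, weight y = k ∧ singlets a b y = 1 := by
  have hsub : Finset.univ.image b ⊆ (Finset.univ.image a)ᶜ := by
    intro i hi
    obtain ⟨j, -, rfl⟩ := Finset.mem_image.1 hi
    simpa using fun i => hab i j
  obtain ⟨s, hs1, hs2, hs3⟩ := Finset.exists_subsuperset_card_eq hsub (n := k)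
    (by rw [Finset.card_image_of_injective _ hb]; simpa using hlk)
    (by
      rw [Finset.card_compl, Finset.card_image_of_injective _ ha]
      simp
      omega)
  refine ⟨fun i => if i ∈ s then 1 else 0, ?_, singlets_eq_one (fun j => ?_) fun j => ?_⟩
  · simp [weight, hs3]
  · have : a j ∉ s := fun h => by simpa using hs2 h
    simp [this]
  · have : b j ∈ s := hs1 (by simp)
    simp [this]

/-- A two-row Specht module embeds into the strings of weight `k` if `k` is at least the length of
the second row and at most the length of the first. -/
theorem spechtToQubits_injective {μ : YoungDiagram} (h2 : μ.rowLen 2 = 0) {k : ℕ}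
    (hlk : μ.rowLen 1 ≤ k) (hk : k + μ.rowLen 1 ≤ n) :
    Function.Injective (spechtToQubits n μ fun j => if j = k then 1 else 0) := by
  set g : ℕ → ℂ := fun j => if j = k then 1 else 0
  refine (injective_iff_map_eq_zero _).2 fun u hu => Subtype.ext ?_
  refine eq_zero_of_columnAntisymmetrizer_eq_zero u.2 fun t => ?_
  have h1 := columnAntisymmetrizer_eq_smul h2 t u.2
  set c := columnAntisymmetrizer (tabloidRep n) t u (tabloid t)
  have h3 : columnAntisymmetrizer (spechtRep n μ) t u = c • ⟨polytabloid t, polytabloid_mem t⟩ :=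
    Subtype.ext ((intertwines_subtype.map_columnAntisymmetrizer t u).trans h1)
  have h4 := (intertwines_spechtToQubits g).map_columnAntisymmetrizer t u
  rw [hu, map_zero, h3, map_smul, spechtToQubits_polytabloid h2] at h4
  obtain ⟨y, hy, hy'⟩ := exists_singlets_ne_zero (upper_injective t) (lower_injective t)
    (upper_ne_lower t) hlk hk
  have h5 := congrFun h4 y
  rw [Pi.smul_apply, weightMul_apply, hy, hy'] at h5
  have h6 : c = 0 := by simpa [g] using h5
  rw [h1, h6, zero_smul]

theorem weightMul_weightMul (g h : ℕ → ℂ) (f : Bits n → ℂ) :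
    weightMul g (weightMul h f) = weightMul (g * h) f := by
  funext y
  simp [weightMul_apply, mul_assoc]

theorem sum_diag_eq_trace (p : Nat.Partition n) (k : ℕ) :
    ∑ x : Bits n with weight x = k, schurProjector p x x =
      LinearMap.trace ℂ _ (Matrix.toLin' (schurProjector p) ∘ₗ
        weightMul fun j => if j = k then 1 else 0) := by
  have : Matrix.toLin' (schurProjector p) ∘ₗ (weightMul fun j => if j = k then 1 else 0) =
      Matrix.toLin' (schurProjector p *
        Matrix.diagonal fun x : Bits n => if weight x = k then 1 else 0) := by
    refine LinearMap.ext fun f => ?_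
    rw [LinearMap.comp_apply, Matrix.toLin'_apply, Matrix.toLin'_apply, ← Matrix.mulVec_mulVec]
    congr 1
    funext y
    rw [Matrix.mulVec_diagonal]
    rfl
  rw [this, Matrix.trace_toLin'_eq, Matrix.trace, Finset.sum_filter]
  refine Finset.sum_congr rfl fun x _ => ?_
  simp

theorem sum_diag_schurProjector {p : Nat.Partition n} (hp : (diagram p).rowLen 2 = 0) {k : ℕ}
    (hk : k ≤ n / 2) : ∑ x : Bits n with weight x = k, schurProjector p x x =
      if guess p ≤ k then (Module.finrank ℂ (spechtModule n (diagram p)) : ℂ) else 0 := by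
  set g : ℕ → ℂ := fun j => if j = k then 1 else 0
  rw [sum_diag_eq_trace]
  split_ifs with hl
  · -- the operator projects onto the copy of the Specht module of weight `k`
    have hproj : LinearMap.IsProj (LinearMap.range (spechtToQubits n (diagram p) g))
        (Matrix.toLin' (schurProjector p) ∘ₗ weightMul g) := by
      constructor
      · intro f
        rw [← Submodule.ker_mkQ (LinearMap.range (spechtToQubits n (diagram p) g)),
          LinearMap.mem_ker, ← LinearMap.comp_apply]
        refine LinearMap.congr_fun (g := 0) (qubit_hom_ext fun q hq h t => ?_) f
        rw [LinearMap.comp_apply, LinearMap.comp_apply, LinearMap.zero_apply, ← LinearMap.mem_ker,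
          Submodule.ker_mkQ, weightMul_weightMul, Matrix.toLin'_apply,
          schurProjector_mulVec_singlets hq]
        split_ifs with h1
        · subst h1
          refine ⟨h k • ⟨polytabloid t, polytabloid_mem t⟩, ?_⟩
          rw [map_smul, spechtToQubits_polytabloid hp]
          funext y
          simp only [Pi.smul_apply, weightMul_apply, Pi.mul_apply, g]
          split_ifs with h3
          · rw [h3]; simp
          · simp
        · exact Submodule.zero_mem _
      · rintro _ ⟨u, rfl⟩
        have h1 : weightMul g (spechtToQubits n (diagram p) g u) =
            spechtToQubits n (diagram p) g u := by
          funext y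
          by_cases hy : weight y = k <;> simp [spechtToQubits, weightMul_apply, g, hy]
        rw [LinearMap.comp_apply, h1, Matrix.toLin'_apply, schurProjector_mulVec_self hp]
    rw [hproj.trace, LinearMap.finrank_range_of_inj
      (spechtToQubits_injective hp hl (by unfold guess at hl; omega))]
  · have h0 : Matrix.toLin' (schurProjector p) ∘ₗ weightMul g = 0 := by
      refine qubit_hom_ext fun q hq h t => ?_
      rw [LinearMap.comp_apply, weightMul_weightMul, Matrix.toLin'_apply,
        schurProjector_mulVec_singlets hq, LinearMap.zero_apply]
      split_ifs with h1
      · subst h1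
        funext y
        rw [weightMul_apply, Pi.zero_apply]
        by_cases hy : weight y = k
        · rw [singlets_eq_zero_of_weight_lt (upper_injective t) (lower_injective t)
            (upper_ne_lower t) (by unfold guess at hl; omega), mul_zero]
        · simp [g, hy]
      · rfl
    rw [h0, map_zero]

theorem permuteQubits_apply_comp (π : Equiv.Perm (Fin n)) (x y : Bits n) (τ : Equiv.Perm (Fin n)) :
    permuteQubits π (y ∘ τ) (x ∘ τ) = permuteQubits (τ * π * τ⁻¹) y x := by
  rw [permuteQubits, permuteQubits, Matrix.of_apply, Matrix.of_apply]
  refine if_congr ?_ rfl rfl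
  rw [comp_inv_eq_iff, comp_inv_eq_iff]
  constructor
  · intro h
    funext i
    simpa using congrFun h (τ⁻¹ i)
  · rintro rfl
    funext i
    simp

/-- The projectors commute with permutations of the qubits, since characters are class
functions. -/
theorem schurProjector_comp (p : Nat.Partition n) (x y : Bits n) (τ : Equiv.Perm (Fin n)) :
    schurProjector p (y ∘ τ) (x ∘ τ) = schurProjector p y x := by
  simp only [schurProjector, Matrix.smul_apply, Matrix.sum_apply, permuteQubits_apply_comp]
  congr 1
  refine Fintype.sum_equiv (MulAut.conj τ).toEquiv _ _ fun π => ?_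
  have h : spechtCharacter n (diagram p) (τ * π * τ⁻¹) = spechtCharacter n (diagram p) π := by
    unfold spechtCharacter
    rw [map_mul, LinearMap.trace_mul_comm, ← map_mul]
    simp
  change _ = spechtCharacter n (diagram p) (τ * π * τ⁻¹) • permuteQubits (τ * π * τ⁻¹) y x
  rw [h]

theorem schurProjector_diag_eq (p : Nat.Partition n) {x y : Bits n} (h : weight x = weight y) :
    schurProjector p x x = schurProjector p y y := by
  obtain ⟨τ, rfl⟩ := exists_comp_eq_of_weight_eq h
  exact (schurProjector_comp p x x τ).symm

theorem card_weight_eq (n k : ℕ) : Finset.card {x : Bits n | weight x = k} = n.choose k := by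
  have h := Finset.card_powersetCard k (Finset.univ : Finset (Fin n))
  rw [Finset.card_univ, Fintype.card_fin] at h
  rw [← h]
  refine Finset.card_bij' (fun x _ => ({i | x i = 1} : Finset (Fin n)))
    (fun s _ => fun i => if i ∈ s then 1 else 0) ?_ ?_ ?_ ?_
  · intro x hx
    exact Finset.mem_powersetCard.2 ⟨Finset.subset_univ _, (Finset.mem_filter.1 hx).2⟩
  · intro s hs
    refine Finset.mem_filter.2 ⟨Finset.mem_univ _, ?_⟩
    simpa [weight] using (Finset.mem_powersetCard.1 hs).2
  · intro x _
    funext i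
    simp only [Finset.mem_filter, Finset.mem_univ, true_and]
    split_ifs with h
    · exact h.symm
    · omega
  · intro s _
    ext i
    simp

/-- The sum of the dimensions of the two-row Specht modules whose second row has length `l`. (There
is one such module if `l ≤ n / 2`, and none otherwise.) -/
def twoRowDim (n l : ℕ) : ℝ :=
  ∑ p : Nat.Partition n with (diagram p).rowLen 2 = 0 ∧ guess p = l,
    (Module.finrank ℂ (spechtModule n (diagram p)) : ℝ)

theorem twoRowDim_nonneg (n l : ℕ) : 0 ≤ twoRowDim n l :=
  Finset.sum_nonneg fun _ _ => Nat.cast_nonneg _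

theorem choose_mul_schurProjector_diag (p : Nat.Partition n) {x : Bits n}
    (hx : weight x ≤ n / 2) : (n.choose (weight x) : ℝ) * (schurProjector p x x).re =
      if (diagram p).rowLen 2 = 0 ∧ guess p ≤ weight x then
        (Module.finrank ℂ (spechtModule n (diagram p)) : ℝ) else 0 := by
  by_cases hp : (diagram p).rowLen 2 = 0
  · have h1 := sum_diag_schurProjector hp hx
    rw [Finset.sum_congr rfl fun y hy =>
      schurProjector_diag_eq p (y := x) (by simpa using hy), Finset.sum_const, card_weight_eq,
      nsmul_eq_mul] at h1
    have h2 := congrArg Complex.re h1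
    rw [← Complex.ofReal_natCast, Complex.re_ofReal_mul] at h2
    rw [h2]
    by_cases hg : guess p ≤ weight x <;> simp [hg, hp]
  · have h0 : schurProjector p x x = 0 := by
      have := congrFun (schurProjector_mulVec_eq_zero hp (Pi.single x 1)) x
      simpa using this
    simp [h0, hp]

/-- On a basis state of weight `k ≤ n / 2`, the guess is `l ≤ k` with probability proportional to
the dimension of the Specht module of shape `(n - l, l)`. -/
theorem choose_mul_sum_guess (F : ℕ → ℝ) {x : Bits n} (hx : weight x ≤ n / 2) :
    (n.choose (weight x) : ℝ) * ∑ p : Nat.Partition n, F (guess p) * (schurProjector p x x).re =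
      ∑ l ∈ Finset.range (weight x + 1), F l * twoRowDim n l := by
  rw [Finset.mul_sum]
  simp_rw [mul_left_comm, choose_mul_schurProjector_diag _ hx, mul_ite, mul_zero]
  rw [← Finset.sum_filter, ← Finset.sum_fiberwise_of_maps_to (g := guess)
    (t := Finset.range (weight x + 1))]
  · refine Finset.sum_congr rfl fun l hl => ?_
    rw [twoRowDim, Finset.mul_sum]
    refine Finset.sum_congr ?_ fun p hp => ?_
    · ext p
      simp only [Finset.mem_filter, Finset.mem_univ, true_and, Finset.mem_range] at hl ⊢
      constructor
      · rintro ⟨⟨h1, h2⟩, h3⟩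
        exact ⟨h1, h3⟩
      · rintro ⟨h1, h3⟩
        exact ⟨⟨h1, by omega⟩, h3⟩
    · rw [(Finset.mem_filter.1 hp).2.2]
  · intro p hp
    simp only [Finset.mem_filter, Finset.mem_univ, true_and] at hp
    exact Finset.mem_range.2 (by omega)

theorem sum_twoRowDim {k : ℕ} (hk : k ≤ n / 2) :
    ∑ l ∈ Finset.range (k + 1), twoRowDim n l = n.choose k := by
  obtain ⟨y, hy, -⟩ := exists_singlets_ne_zero (n := n) (l := 0) (k := k) (a := Fin.elim0)
    (b := Fin.elim0) (fun i => i.elim0) (fun i => i.elim0) (fun i => i.elim0) (by omega) (by omega)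
  have h := choose_mul_sum_guess (fun _ => 1) (x := y) (by omega)
  simp only [one_mul, hy] at h
  rw [← h, ← Complex.re_sum, ← Matrix.sum_apply, sum_schurProjector]
  simp

end Distribution

/-! ### Invariance of the outcome under a change of basis and a permutation -/

section Invariance

variable {n : ℕ}

theorem permuteQubits_mul_comm (π : Equiv.Perm (Fin n)) {A : Matrix (Bits n) (Bits n) ℂ}
    (hA : ∀ (τ : Equiv.Perm (Fin n)) y x, A (y ∘ τ) (x ∘ τ) = A y x) :
    permuteQubits π * A = A * permuteQubits π := by
  ext y x
  have h1 : ∀ z, permuteQubits π y z = if z = y ∘ π then 1 else 0 := fun z =>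
    if_congr (comp_inv_eq_iff π z y) rfl rfl
  rw [Matrix.mul_apply, Matrix.mul_apply]
  simp_rw [h1]
  have h2 : (x ∘ ⇑π⁻¹) ∘ π = x := ((comp_inv_eq_iff π x _).1 rfl).symm
  have h3 := hA π y (x ∘ ⇑π⁻¹)
  rw [h2] at h3
  simpa [permuteQubits] using! h3

theorem tensorPower_comp (U : Matrix (Fin 2) (Fin 2) ℂ) (τ : Equiv.Perm (Fin n)) (y x : Bits n) :
    tensorPower n U (y ∘ τ) (x ∘ τ) = tensorPower n U y x := by
  simp only [tensorPower, Matrix.of_apply, Function.comp_apply]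
  exact Equiv.prod_comp τ fun i => U (y i) (x i)

theorem schurProjector_mul_permuteQubits (p : Nat.Partition n) (σ : Equiv.Perm (Fin n)) :
    schurProjector p * permuteQubits σ = permuteQubits σ * schurProjector p :=
  (permuteQubits_mul_comm σ fun τ y x => schurProjector_comp p x y τ).symm

theorem schurProjector_mul_tensorPower (p : Nat.Partition n) (U : Matrix (Fin 2) (Fin 2) ℂ) :
    schurProjector p * tensorPower n U = tensorPower n U * schurProjector p := by
  simp only [schurProjector, Matrix.smul_mul, Matrix.mul_smul, Finset.sum_mul, Finset.mul_sum,
    permuteQubits_mul_comm _ (tensorPower_comp U)]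

theorem permuteQubits_unitary (σ : Equiv.Perm (Fin n)) :
    (permuteQubits σ)ᴴ * permuteQubits σ = 1 := by
  have h : (permuteQubits σ)ᴴ = permuteQubits σ⁻¹ := by
    rw [← permuteQubits_transpose]
    ext y x
    simp only [permuteQubits, Matrix.conjTranspose_apply, Matrix.transpose_apply, Matrix.of_apply]
    split_ifs <;> simp
  rw [h]
  apply Matrix.toLin'.injective
  refine LinearMap.ext fun f => ?_
  rw [Matrix.toLin'_apply, ← Matrix.mulVec_mulVec, permuteQubits_mulVec, permuteQubits_mulVec,
    ← Module.End.mul_apply, ← map_mul]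
  simp

theorem tensorPower_unitary (U : Matrix.unitaryGroup (Fin 2) ℂ) :
    (tensorPower n (U : Matrix (Fin 2) (Fin 2) ℂ))ᴴ *
      tensorPower n (U : Matrix (Fin 2) (Fin 2) ℂ) = 1 := by
  ext y x
  have hU : (U : Matrix (Fin 2) (Fin 2) ℂ)ᴴ * (U : Matrix (Fin 2) (Fin 2) ℂ) = 1 :=
    Matrix.mem_unitaryGroup_iff'.1 U.2
  have h1 : ∀ i, ∑ a, star ((U : Matrix (Fin 2) (Fin 2) ℂ) a (y i)) *
      (U : Matrix (Fin 2) (Fin 2) ℂ) a (x i) = if y i = x i then 1 else 0 := by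
    intro i
    rw [← Matrix.one_apply, ← hU, Matrix.mul_apply]
    rfl
  have h2 := Finset.prod_univ_sum (fun _ : Fin n => (Finset.univ : Finset (Fin 2))) fun i a =>
    star ((U : Matrix (Fin 2) (Fin 2) ℂ) a (y i)) * (U : Matrix (Fin 2) (Fin 2) ℂ) a (x i)
  rw [Fintype.piFinset_univ] at h2
  rw [Matrix.mul_apply]
  simp only [Matrix.conjTranspose_apply, tensorPower, Matrix.of_apply, star_prod,
    ← Finset.prod_mul_distrib]
  rw [← h2, Finset.prod_congr rfl fun i _ => h1 i, Matrix.one_apply]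
  by_cases hyx : y = x
  · simp [hyx]
  · obtain ⟨i, hi⟩ := Function.ne_iff.1 hyx
    rw [if_neg hyx]
    exact Finset.prod_eq_zero (Finset.mem_univ i) (if_neg hi)

/-- The outcome on a scrambled state is distributed as on the basis state. -/
theorem prob_weakSchurSampling (p : Nat.Partition n) (x : Bits n)
    (U : Matrix.unitaryGroup (Fin 2) ℂ) (σ : Equiv.Perm (Fin n)) :
    (weakSchurSampling n).prob (scrambled x U σ) p = (schurProjector p x x).re := by
  set V := permuteQubits σ * tensorPower n (U : Matrix (Fin 2) (Fin 2) ℂ) with hV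
  have hs : scrambled x U σ = V *ᵥ Pi.single x 1 := by
    rw [scrambled, Matrix.mulVec_mulVec]
  have hc : schurProjector p * V = V * schurProjector p := by
    rw [hV, ← mul_assoc, schurProjector_mul_permuteQubits, mul_assoc,
      schurProjector_mul_tensorPower, mul_assoc]
  have hu : Vᴴ * V = 1 := by
    rw [hV, Matrix.conjTranspose_mul, mul_assoc, ← mul_assoc _ (permuteQubits σ),
      permuteQubits_unitary, one_mul, tensorPower_unitary]
  change (star (scrambled x U σ) ⬝ᵥ (schurProjector p *ᵥ scrambled x U σ)).re = _
  rw [hs, Matrix.mulVec_mulVec, hc, Matrix.star_mulVec, ← Matrix.dotProduct_mulVec,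
    Matrix.mulVec_mulVec, ← mul_assoc, hu, one_mul]
  congr 1
  rw [← Pi.single_star]
  simp

theorem prob_correctedGuess (f : ℕ → Fin 2) (q : Fin 2 → PMF (Fin 2)) (x : Bits n)
    (U : Matrix.unitaryGroup (Fin 2) ℂ) (σ : Equiv.Perm (Fin n)) (c : Fin 2) :
    (correctedGuess (weakSchurSampling n) f q).prob (scrambled x U σ) c =
      ∑ p : Nat.Partition n, (q (f (guess p)) c).toReal * (schurProjector p x x).re := by
  simp_rw [← prob_weakSchurSampling _ x U σ]
  simp only [Measurement.prob, correctedGuess, Measurement.postprocess, Matrix.sum_mulVec,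
    dotProduct_sum, Complex.re_sum, Matrix.smul_mulVec, dotProduct_smul, smul_eq_mul,
    Complex.re_ofReal_mul]

/-- The success probability of a corrected guess, times the number of strings of the given
weight. -/
theorem choose_mul_prob (f : ℕ → Fin 2) (q : Fin 2 → PMF (Fin 2)) {x : Bits n}
    (hx : weight x ≤ n / 2) (U : Matrix.unitaryGroup (Fin 2) ℂ) (σ : Equiv.Perm (Fin n))
    (c : Fin 2) : (n.choose (weight x) : ℝ) *
      (correctedGuess (weakSchurSampling n) f q).prob (scrambled x U σ) c =
      ∑ l ∈ Finset.range (weight x + 1), (q (f l) c).toReal * twoRowDim n l := by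
  rw [prob_correctedGuess, choose_mul_sum_guess (fun l => (q (f l) c).toReal) hx]

end Invariance

/-! ### Correcting the guess -/

section Correction

variable {n : ℕ}

/-- The distribution of a bit which equals `c` with probability `s`. -/
def coin (c : Fin 2) (s : ℝ) (h0 : 0 ≤ s) (h1 : s ≤ 1) : PMF (Fin 2) :=
  PMF.ofFintype (fun b => if b = c then ENNReal.ofReal s else ENNReal.ofReal (1 - s)) <| by
    have hs : ENNReal.ofReal s + ENNReal.ofReal (1 - s) = 1 := by
      rw [← ENNReal.ofReal_add h0 (by linarith)]
      simp
    rcases (by omega : c = 0 ∨ c = 1) with rfl | rfl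
    · simpa [Fin.sum_univ_two] using hs
    · rw [add_comm] at hs
      simpa [Fin.sum_univ_two] using hs

theorem toReal_coin (c : Fin 2) (s : ℝ) (h0 : 0 ≤ s) (h1 : s ≤ 1) (b : Fin 2) :
    (coin c s h0 h1 b).toReal = if b = c then s else 1 - s := by
  rw [coin, PMF.ofFintype_apply]
  split_ifs
  · exact ENNReal.toReal_ofReal h0
  · exact ENNReal.toReal_ofReal (by linarith)

theorem choose_pos_of_le_half {k : ℕ} (hk : k ≤ n / 2) : (0 : ℝ) < n.choose k := by
  exact_mod_cast Nat.choose_pos (by omega)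

theorem choose_mono_of_le_half {j k : ℕ} (hjk : j ≤ k) (hk : k ≤ n / 2) :
    (n.choose j : ℝ) ≤ n.choose k := by
  rw [← sum_twoRowDim (hjk.trans hk), ← sum_twoRowDim hk]
  exact Finset.sum_le_sum_of_subset_of_nonneg (by simpa using hjk)
    fun l _ _ => twoRowDim_nonneg n l

theorem choose_succ_mul {k : ℕ} (hk : k ≤ n) :
    (n.choose (k + 1) : ℝ) * (k + 1) = n.choose k * (n - k) := by
  have := Nat.choose_succ_right_eq n k
  rw [← Nat.cast_sub hk]
  exact_mod_cast this

/-- The corrected threshold guess: a guess of at least `t` is kept, and a smaller one is turned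
into the answer `1` with probability `t / (n + 1)`. -/
theorem threshold_success (t : ℕ) : ∃ q : Fin 2 → PMF (Fin 2),
    ∀ x : Bits n, weight x ≤ n / 2 →
    ∀ (U : Matrix.unitaryGroup (Fin 2) ℂ) (σ : Equiv.Perm (Fin n)),
      1 - (t : ℝ) / ((n : ℝ) + 1) ≤
        (correctedGuess (weakSchurSampling n) (thresholdOfWeight t) q).prob (scrambled x U σ)
          (threshold t x) := by
  have hn : (0 : ℝ) < (n : ℝ) + 1 := by positivity
  by_cases ht : t ≤ n / 2
  · -- a guess below the threshold is corrected with probability `r`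
    set r : ℝ := (t : ℝ) / ((n : ℝ) + 1) with hr
    have hr0 : 0 ≤ r := by positivity
    have hr1 : r ≤ 1 := by
      rw [hr, div_le_one hn]
      exact_mod_cast (by omega : t ≤ n + 1)
    refine ⟨fun b => if b = 1 then coin 1 1 zero_le_one le_rfl else coin 1 r hr0 hr1, ?_⟩
    intro x hx U σ
    have hC := choose_pos_of_le_half hx
    refine le_of_mul_le_mul_left ?_ hC
    rw [choose_mul_prob _ _ hx]
    by_cases hk : t ≤ weight x
    · have hth : threshold t x = 1 := if_pos hk
      rw [hth]
      have hterm : ∀ l, ((if thresholdOfWeight t l = 1 then coin 1 1 zero_le_one le_rfl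
          else coin 1 r hr0 hr1) 1).toReal * twoRowDim n l =
          twoRowDim n l - (1 - r) * if l < t then twoRowDim n l else 0 := by
        intro l
        unfold thresholdOfWeight
        by_cases hl : t ≤ l
        · simp [hl, not_lt.2 hl, toReal_coin]
        · simp [hl, toReal_coin, not_le.1 hl]
          ring
      rw [Finset.sum_congr rfl fun l _ => hterm l, Finset.sum_sub_distrib, ← Finset.mul_sum,
        ← Finset.sum_filter, sum_twoRowDim hx]
      have hf : (Finset.range (weight x + 1)).filter (· < t) = Finset.range t := by
        ext l
        simp only [Finset.mem_filter, Finset.mem_range]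
        omega
      rw [hf]
      have hkey : (1 - r) * ∑ l ∈ Finset.range t, twoRowDim n l ≤ r * n.choose (weight x) := by
        rcases t with _ | s
        · simp [hr]
        · rw [sum_twoRowDim (by omega)]
          have h1 := choose_succ_mul (n := n) (k := s) (by omega)
          have h2 := choose_mono_of_le_half hk hx
          have h3 : (1 - r) * (n.choose s : ℝ) = r * n.choose (s + 1) := by
            rw [hr]
            push_cast
            field_simp
            linarith
          rw [h3]
          exact mul_le_mul_of_nonneg_left h2 hr0
      linarith
    · have hth : threshold t x = 0 := if_neg hk
      rw [hth, ← sum_twoRowDim hx, mul_comm, Finset.mul_sum]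
      refine Finset.sum_le_sum fun l hl => ?_
      have hl' : ¬t ≤ l := by
        have := Finset.mem_range.1 hl
        omega
      simp [thresholdOfWeight, hl', toReal_coin]
  · -- no admissible weight reaches the threshold
    refine ⟨fun _ => coin 0 1 zero_le_one le_rfl, fun x hx U σ => ?_⟩
    have hC := choose_pos_of_le_half hx
    have hth : threshold t x = 0 := if_neg (by omega)
    refine le_of_mul_le_mul_left ?_ hC
    rw [choose_mul_prob _ _ hx, hth]
    simp only [toReal_coin, if_true, one_mul]
    rw [sum_twoRowDim hx]
    have : 0 ≤ (t : ℝ) / ((n : ℝ) + 1) := by positivity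
    nlinarith

theorem parityOfWeight_eq_iff (j k : ℕ) :
    parityOfWeight j = parityOfWeight k ↔ (Odd j ↔ Odd k) := by
  unfold parityOfWeight
  by_cases hj : Odd j <;> by_cases hk : Odd k <;> simp [hj, hk]

theorem parity_eq (x : Bits n) : parity x = parityOfWeight (weight x) := by
  have h : ∀ s : Finset (Fin n),
      ∑ i ∈ s, x i = parityOfWeight (Finset.card (s.filter fun i => x i = 1)) := by
    intro s
    induction s using Finset.induction_on with
    | empty => rfl
    | insert i s hi ih =>
      rw [Finset.sum_insert hi, ih, Finset.filter_insert]
      split_ifs with h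
      · rw [Finset.card_insert_of_notMem (by simp [hi]), h]
        unfold parityOfWeight
        by_cases ho : Odd (Finset.card (s.filter fun i => x i = 1)) <;>
          simp [ho, Nat.odd_add_one]
      · have h0 : x i = 0 := by omega
        rw [h0, zero_add]
  exact h Finset.univ

/-- Among the two-row Specht modules with `l ≤ k`, those with `l` of the same parity as `k` make up
the fraction `(n - k) / n` of the total dimension: their dimension is the alternating sum of the
binomial coefficients up to `k`. -/
theorem mul_sum_same_parity {k : ℕ} (hk : k ≤ n / 2) :
    (n : ℝ) * ∑ l ∈ Finset.range (k + 1),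
      (if parityOfWeight l = parityOfWeight k then twoRowDim n l else 0) =
      (n - k) * n.choose k := by
  induction k with
  | zero =>
    have := sum_twoRowDim (n := n) (k := 0) (by omega)
    simp only [zero_add, Finset.sum_range_one] at this ⊢
    simp [this]
  | succ k ih =>
    have h := ih (by omega)
    have hsplit : ∑ l ∈ Finset.range (k + 1 + 1),
        (if parityOfWeight l = parityOfWeight (k + 1) then twoRowDim n l else 0) =
        n.choose (k + 1) - ∑ l ∈ Finset.range (k + 1),
          (if parityOfWeight l = parityOfWeight k then twoRowDim n l else 0) := by
      rw [← sum_twoRowDim hk, Finset.sum_range_succ, Finset.sum_range_succ _ (k + 1), if_pos rfl,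
        add_sub_right_comm, ← Finset.sum_sub_distrib]
      congr 1
      refine Finset.sum_congr rfl fun l _ => ?_
      have : parityOfWeight l = parityOfWeight (k + 1) ↔ ¬parityOfWeight l = parityOfWeight k := by
        rw [parityOfWeight_eq_iff, parityOfWeight_eq_iff, Nat.odd_add_one]
        tauto
      by_cases hl : parityOfWeight l = parityOfWeight k
      · rw [if_neg fun h => this.1 h hl, if_pos hl, sub_self]
      · rw [if_pos (this.2 hl), if_neg hl, sub_zero]
    have h1 := choose_succ_mul (n := n) (k := k) (by omega)
    rw [hsplit, mul_sub, h]
    push_cast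
    linarith

/-- The corrected parity guess: the parity of `n / 2` is kept as a guess, and the other parity is
turned into it with probability `1 / (n + 1)`. -/
theorem parity_success : ∃ q : Fin 2 → PMF (Fin 2),
    ∀ x : Bits n, weight x ≤ n / 2 →
    ∀ (U : Matrix.unitaryGroup (Fin 2) ℂ) (σ : Equiv.Perm (Fin n)),
      1 / 2 + 1 / (2 * ((n : ℝ) + 1)) ≤
        (correctedGuess (weakSchurSampling n) parityOfWeight q).prob (scrambled x U σ)
          (parity x) := by
  have hn : (0 : ℝ) < (n : ℝ) + 1 := by positivity
  -- weight `n / 2` is the hardest, so its parity is favoured with probability `r`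
  set r : ℝ := 1 / ((n : ℝ) + 1) with hr
  have hr0 : 0 ≤ r := by positivity
  have hr1 : r ≤ 1 := by
    rw [hr, div_le_one hn]
    linarith [(Nat.cast_nonneg n : (0 : ℝ) ≤ n)]
  have hgoal : 1 / 2 + 1 / (2 * ((n : ℝ) + 1)) = (1 + r) / 2 := by
    rw [hr]
    field_simp
  set c := parityOfWeight (n / 2) with hc
  refine ⟨fun b => if b = c then coin c 1 zero_le_one le_rfl else coin c r hr0 hr1, ?_⟩
  intro x hx U σ
  have hC := choose_pos_of_le_half hx
  refine le_of_mul_le_mul_left ?_ hC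
  rw [choose_mul_prob _ _ hx, parity_eq, hgoal]
  have hE := mul_sum_same_parity hx
  have hS := sum_twoRowDim hx
  set k := weight x with hk
  set E := ∑ l ∈ Finset.range (k + 1),
    (if parityOfWeight l = parityOfWeight k then twoRowDim n l else 0) with hEdef
  by_cases hkc : parityOfWeight k = c
  · have hterm : ∀ l, ((if parityOfWeight l = c then coin c 1 zero_le_one le_rfl
        else coin c r hr0 hr1) (parityOfWeight k)).toReal * twoRowDim n l =
        r * twoRowDim n l + (1 - r) *
          if parityOfWeight l = parityOfWeight k then twoRowDim n l else 0 := by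
      intro l
      rw [hkc]
      by_cases hl : parityOfWeight l = c
      · simp only [hl, if_true, toReal_coin]
        ring
      · simp [hl, toReal_coin]
    rw [Finset.sum_congr rfl fun l _ => hterm l, Finset.sum_add_distrib, ← Finset.mul_sum,
      ← Finset.mul_sum, hS, ← hEdef]
    have hhalf : (n.choose k : ℝ) ≤ 2 * E := by
      rcases Nat.eq_zero_or_pos n with h0 | hpos
      · have hk0 : k = 0 := by omega
        rw [hk0] at hS hEdef
        simp only [zero_add, Finset.sum_range_one, if_true] at hS hEdef
        rw [hEdef, hk0, ← hS]
        linarith [twoRowDim_nonneg n 0]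
      · have hpos' : (0 : ℝ) < n := by exact_mod_cast hpos
        have h2k : 2 * (k : ℝ) ≤ n := by exact_mod_cast (by omega : 2 * k ≤ n)
        refine le_of_mul_le_mul_left ?_ hpos'
        nlinarith
    nlinarith
  · have hterm : ∀ l, ((if parityOfWeight l = c then coin c 1 zero_le_one le_rfl
        else coin c r hr0 hr1) (parityOfWeight k)).toReal * twoRowDim n l =
        (1 - r) * if parityOfWeight l = parityOfWeight k then twoRowDim n l else 0 := by
      intro l
      by_cases hl : parityOfWeight l = c
      · have hlk : ¬c = parityOfWeight k := fun h => hkc h.symm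
        simp [hl, hkc, hlk, toReal_coin]
      · have hlk : parityOfWeight l = parityOfWeight k := by omega
        simp [hlk, hkc, toReal_coin]
    rw [Finset.sum_congr rfl fun l _ => hterm l, ← Finset.mul_sum, ← hEdef]
    have hne : k ≠ n / 2 := fun h => hkc (by rw [h])
    have h2k : 2 * (k : ℝ) + 2 ≤ n := by exact_mod_cast (by omega : 2 * k + 2 ≤ n)
    have h3 : (1 - r) * E = (n - k) * n.choose k / (n + 1) := by
      rw [← hE, hr]
      field_simp
      ring
    have h4 : (n.choose k : ℝ) * ((1 + r) / 2) = (n + 2) / 2 * n.choose k / (n + 1) := by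
      rw [hr]
      field_simp
      ring
    rw [h3, h4]
    gcongr
    linarith

end Correction

end HiddenBasis

end

theorem corollary1 (n : ℕ) :
    -- weak Schur sampling is a measurement `W`
    ∃ W : Measurement (Bits n) (Nat.Partition n), (∀ p, W.effect p = schurProjector p) ∧
      (∀ t : ℕ, ∃ q : Fin 2 → PMF (Fin 2),
        ∀ x : Bits n, weight x ≤ n / 2 →
        ∀ (U : Matrix.unitaryGroup (Fin 2) ℂ) (σ : Equiv.Perm (Fin n)),
          1 - (t : ℝ) / ((n : ℝ) + 1) ≤
            (correctedGuess W (thresholdOfWeight t) q).prob (scrambled x U σ) (threshold t x)) ∧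
      (∃ q : Fin 2 → PMF (Fin 2),
        ∀ x : Bits n, weight x ≤ n / 2 →
        ∀ (U : Matrix.unitaryGroup (Fin 2) ℂ) (σ : Equiv.Perm (Fin n)),
          1 / 2 + 1 / (2 * ((n : ℝ) + 1)) ≤
            (correctedGuess W parityOfWeight q).prob (scrambled x U σ) (parity x)) := by
  exact ⟨weakSchurSampling n, fun _ => rfl, threshold_success, parity_success⟩
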